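/- Let $r\ge 2$ and let $\psi\in C^\infty(\mathbb{R})$ satisfy $\psi''>0$ everywhere. On $\mathbb{R}^{2r+2}$ with coordinates $(u_1,\dots,u_r,v_1,\dots,v_r,x,y)$ let $g=g_{3,r,\psi}$ be the symmetric $2$-tensor whose non-zero components, up to symmetry, are $$g(\partial_x,\partial_y)=1,\quad g(\partial_{u_i},\partial_{v_j})=\delta_{ij},\quad g(\partial_x,\partial_x)=-2u_1v_2-\dots-2u_{r-1}v_r-2\psi(u_r),$$ and let $\mathcal{M}=(\mathbb{R}^{2r+2},g)$. Let $\nabla$ be the Levi-Civita connection, $R(X,Y)=\nabla_X\nabla_Y-\nabla_Y\nabla_X-\nabla_{[X,Y]}$ and $R(X,Y,Z,W)=g(R(X,Y)Z,W)$; the slot after the semicolon in $\nabla R(\cdot,\cdot,\cdot,\cdot;\cdot)$ is the direction of differentiation. A $0$-model space is a triple $(V,g_V,A)$ with $V$ a finite-dimensional real vector space, $g_V$ a non-degenerate symmetric inner product and $A\in\otimes^4V^*$ a tensor with the symmetries of the Riemann curvature tensor; a $1$-model space has in addition a tensor $A^1\in\otimes^5V^*$ with the symmetries of the covariant derivative of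 the curvature tensor (including the second Bianchi identity); a $k$-model space has tensors $A^j\in\otimes^{4+j}V^*$ for $0\le j\le k$, where $A^0=A$. It is a $k$-model for $\mathcal{M}$ if for every point $P$ there is a linear isomorphism $\Phi_P:T_P\mathcal{M}\to V$ with $\Phi_P^*g_V=g_P$ and $\Phi_P^*A^j=\nabla^jR_P$ for $0\le j\le k$; $\mathcal{M}$ is $k$-curvature homogeneous if it admits a $k$-model. A $0$-model space is irreducible if it has no non-trivial decomposition $V=W_1\oplus W_2$, $g_V=g_1\oplus g_2$, $A=A_1\oplus A_2$. On $\mathbb{R}^{2r+2}=\operatorname{Span}\{U_1,\dots,U_r,V_1,\dots,V_r,X,Y\}$ let $\mathcal{U}_{3,r}=(\mathbb{R}^{2r+2},g_{3,r},A_{3,r})$ and $\mathcal{U}^1_{3,r}=(\mathbb{R}^{2r+2},g_{3,r},A_{3,r},A^1_{3,r})$, where the non-zero entries, up to the usual $\mathbb{Z}_2$ symmetries, are $$g_{3,r}(X,Y)=1,\quad g_{3,r}(U_i,V_i)=1,\quad A_{3,r}(X,U_r,U_r,X)=1,\quad A_{3,r}(X,U_i,V_{i+1},X)=1\ (1\le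 i\le r-1),$$ $$A^1_{3,r}(X,U_r,U_r,X;U_r)=1.$$ Then $g$ is a pseudo-Riemannian metric of neutral signature $(r+1,r+1)$, and: 1. All geodesics of $\mathcal{M}$ extend for infinite time. 2. For every $P$, $\exp_P:T_P\mathbb{R}^{2r+2}\to\mathbb{R}^{2r+2}$ is a diffeomorphism. 3. Up to the usual $\mathbb{Z}_2$ symmetries, the only possibly non-zero components of $R$ and $\nabla R$ are $R(\partial_x,\partial_{u_r},\partial_{u_r},\partial_x)=\psi''(u_r)$, $R(\partial_x,\partial_{u_i},\partial_{v_{i+1}},\partial_x)=1$ for $1\le i\le r-1$, and $\nabla R(\partial_x,\partial_{u_r},\partial_{u_r},\partial_x;\partial_{u_r})=\psi'''(u_r)$. 4. $\mathcal{U}_{3,r}$ is irreducible and is a $0$-model for $\mathcal{M}$. 5. If $\psi(t)=t^2$ for all $t$, then $\mathcal{M}$ is an irreducible symmetric space: for every $P$ the geodesic symmetry $\exp_P(v)\mapsto\exp_P(-v)$ is an isometry of $\mathcal{M}$ (it fixes $P$ and has differential $-1$ there), $\nabla R=0$, every $(T_P\mathcal{M},g_P,R_P)$ is irreducible, and the tangent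 bundle is not the orthogonal direct sum of two non-zero parallel subbundles. 6. If $\psi'''>0$ everywhere, then $\mathcal{U}^1_{3,r}$ is a $1$-model for $\mathcal{M}$, so $\mathcal{M}$ is $1$-curvature homogeneous, but $\mathcal{M}$ is not $2$-curvature homogeneous. -/

import Mathlib

open scoped Manifold ContDiff

noncomputable section

namespace CurvHom

/-! ### Pseudo-Riemannian geometry of `ℝ^ι` in its global coordinates

A metric is given by its matrix of components `g p i j = g_p(∂_i, ∂_j)`. -/

section Geometry

variable {ι : Type} [Fintype ι] [DecidableEq ι]

/-- The partial derivative `∂_i f` at the point `p`. -/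
def pd (f : (ι → ℝ) → ℝ) (i : ι) (p : ι → ℝ) : ℝ :=
  fderiv ℝ f p (Pi.single i 1)

/-- The field of matrices `g` is a (smooth, symmetric, non-degenerate) pseudo-Riemannian metric. -/
structure IsPseudoRiemannian (g : (ι → ℝ) → Matrix ι ι ℝ) : Prop where
  smooth : ∀ i j, ContDiff ℝ ∞ (fun p => g p i j)
  symm : ∀ p i j, g p i j = g p j i
  nondegenerate : ∀ p, IsUnit (g p).det

/-- The symmetric bilinear form `B` has signature `(m, n)`: the space is the direct sum of an
`m`-dimensional subspace on which `B` is negative definite and an `n`-dimensional subspace on which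
`B` is positive definite. -/
def HasSignature {V : Type} [AddCommGroup V] [Module ℝ V]
    (B : LinearMap.BilinForm ℝ V) (m n : ℕ) : Prop :=
  (∀ x y, B x y = B y x) ∧
  ∃ W₁ W₂ : Submodule ℝ V, IsCompl W₁ W₂ ∧
    Module.finrank ℝ W₁ = m ∧ Module.finrank ℝ W₂ = n ∧
    (∀ x ∈ W₁, x ≠ 0 → B x x < 0) ∧ (∀ x ∈ W₂, x ≠ 0 → 0 < B x x)

/-- The Christoffel symbols of the Levi-Civita connection:
`∇_{∂_i} ∂_j = ∑ k, christoffel g p k i j • ∂_k`. -/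
def christoffel (g : (ι → ℝ) → Matrix ι ι ℝ) (p : ι → ℝ) (k i j : ι) : ℝ :=
  (1 / 2) * ∑ l, (g p)⁻¹ k l *
    (pd (fun q => g q j l) i p + pd (fun q => g q i l) j p - pd (fun q => g q i j) l p)

/-- `curvatureOp g p i j k l` is the `∂_l`-component of `R(∂_i, ∂_j) ∂_k`, where
`R(X, Y) = ∇_X ∇_Y - ∇_Y ∇_X - ∇_[X, Y]`. -/
def curvatureOp (g : (ι → ℝ) → Matrix ι ι ℝ) (p : ι → ℝ) (i j k l : ι) : ℝ :=
  pd (fun q => christoffel g q l j k) i p - pd (fun q => christoffel g q l i k) j p +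
    ∑ m, (christoffel g p m j k * christoffel g p l i m -
      christoffel g p m i k * christoffel g p l j m)

/-- Covariant tensor fields of rank `n` on `ℝ^ι`, given by their components
`T p s = T_p(∂_{s 0}, …, ∂_{s (n-1)})`. -/
abbrev TensorField (ι : Type) (n : ℕ) : Type := (ι → ℝ) → (Fin n → ι) → ℝ

/-- The curvature tensor `R(X, Y, Z, W) = g(R(X, Y) Z, W)`. -/
def riemann (g : (ι → ℝ) → Matrix ι ι ℝ) : TensorField ι 4 := fun p s =>
  ∑ m, curvatureOp g p (s 0) (s 1) (s 2) m * g p m (s 3)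

/-- The covariant derivative `∇T`; the direction of differentiation is the last slot:
`∇T(∂_{i_1}, …, ∂_{i_n}; ∂_j) = ∂_j (T(∂_{i_1}, …, ∂_{i_n})) - ∑ a, T(…, ∇_{∂_j} ∂_{i_a}, …)`. -/
def covDeriv (g : (ι → ℝ) → Matrix ι ι ℝ) {n : ℕ} (T : TensorField ι n) :
    TensorField ι (n + 1) := fun p s =>
  pd (fun q => T q (fun a => s a.castSucc)) (s (Fin.last n)) p -
    ∑ a : Fin n, ∑ l, christoffel g p l (s (Fin.last n)) (s a.castSucc) *
      T p (Function.update (fun b => s b.castSucc) a l)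

/-- The iterated covariant derivative `∇^j R` of the curvature tensor. -/
def nablaR (g : (ι → ℝ) → Matrix ι ι ℝ) : (j : ℕ) → TensorField ι (4 + j)
  | 0 => riemann g
  | j + 1 => covDeriv g (nablaR g j)

/-- The multilinear form on `ℝ^ι` with the given components. -/
def ofComponents {n : ℕ} (T : (Fin n → ι) → ℝ) :
    MultilinearMap ℝ (fun _ : Fin n => ι → ℝ) ℝ :=
  ∑ s : Fin n → ι, T s • (MultilinearMap.mkPiAlgebra ℝ (Fin n) ℝ).compLinearMap
    (fun a => LinearMap.proj (s a))

/-- `γ` is a geodesic of `g` on the open set `s` of parameters. -/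
def IsGeodesicOn (g : (ι → ℝ) → Matrix ι ι ℝ) (γ : ℝ → ι → ℝ) (s : Set ℝ) : Prop :=
  ContDiffOn ℝ 2 γ s ∧ ∀ t ∈ s, ∀ k,
    deriv (deriv γ) t k +
      ∑ i, ∑ j, christoffel g (γ t) k i j * deriv γ t i * deriv γ t j = 0

/-- Geodesic completeness: every geodesic, defined on any open interval, extends to a geodesic
defined on all of `ℝ`. -/
def IsGeodesicallyComplete (g : (ι → ℝ) → Matrix ι ι ℝ) : Prop :=
  ∀ (s : Set ℝ) (γ : ℝ → ι → ℝ), IsOpen s → s.OrdConnected → IsGeodesicOn g γ s →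
    ∃ σ : ℝ → ι → ℝ, IsGeodesicOn g σ Set.univ ∧ Set.EqOn σ γ s

/-- `exp_P(v)` is defined and equal to `Q`: some geodesic, defined on an open interval that
contains `[0, 1]`, starts at `P` with velocity `v` and is at `Q` at time `1`. -/
def ExpEq (g : (ι → ℝ) → Matrix ι ι ℝ) (P v Q : ι → ℝ) : Prop :=
  ∃ (s : Set ℝ) (γ : ℝ → ι → ℝ), IsOpen s ∧ s.OrdConnected ∧ Set.Icc 0 1 ⊆ s ∧
    IsGeodesicOn g γ s ∧ γ 0 = P ∧ deriv γ 0 = v ∧ γ 1 = Q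

/-- `exp_P` is everywhere defined, single-valued, and a diffeomorphism of `T_P ℝ^ι = ℝ^ι` onto
`ℝ^ι`. -/
def ExpIsDiffeo (g : (ι → ℝ) → Matrix ι ι ℝ) (P : ι → ℝ) : Prop :=
  ∃ Φ : Diffeomorph 𝓘(ℝ, ι → ℝ) 𝓘(ℝ, ι → ℝ) (ι → ℝ) (ι → ℝ) ∞,
    ∀ v Q, ExpEq g P v Q ↔ Φ v = Q

/-- The diffeomorphism `S` is an isometry of `g`. -/
def IsIsometry (g : (ι → ℝ) → Matrix ι ι ℝ)
    (S : Diffeomorph 𝓘(ℝ, ι → ℝ) 𝓘(ℝ, ι → ℝ) (ι → ℝ) (ι → ℝ) ∞) : Prop :=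
  ∀ p v w, Matrix.toBilin' (g (S p)) (fderiv ℝ S p v) (fderiv ℝ S p w) =
    Matrix.toBilin' (g p) v w

/-- Symmetric space: for every point `P` there is a global isometry which is the geodesic symmetry
`exp_P(v) ↦ exp_P(-v)` at `P`; it fixes `P`, and its differential at `P` is `-1`. -/
def IsSymmetricSpace (g : (ι → ℝ) → Matrix ι ι ℝ) : Prop :=
  ∀ P, ∃ S : Diffeomorph 𝓘(ℝ, ι → ℝ) 𝓘(ℝ, ι → ℝ) (ι → ℝ) (ι → ℝ) ∞,
    IsIsometry g S ∧ S P = P ∧ (∀ v, fderiv ℝ S P v = -v) ∧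
    ∀ v Q Q', ExpEq g P v Q → ExpEq g P (-v) Q' → S Q = Q'

/-- The tangent bundle is not the orthogonal direct sum of two non-zero parallel subbundles: a
smooth, parallel, self-adjoint field of projections is trivial. -/
def HasNoParallelSplitting (g : (ι → ℝ) → Matrix ι ι ℝ) : Prop :=
  ∀ E : (ι → ℝ) → Matrix ι ι ℝ,
    (∀ k i, ContDiff ℝ ∞ (fun p => E p k i)) →
    (∀ p, E p * E p = E p) →
    (∀ p v w, Matrix.toBilin' (g p) ((E p).mulVec v) w =
      Matrix.toBilin' (g p) v ((E p).mulVec w)) →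
    (∀ p i j k, pd (fun q => E q k i) j p + ∑ m, christoffel g p k j m * E p m i -
      ∑ m, christoffel g p m j i * E p k m = 0) →
    (∀ p, E p = 0) ∨ (∀ p, E p = 1)

end Geometry

/-! ### Algebraic models -/

section Models

variable {V : Type} [AddCommGroup V] [Module ℝ V]

/-- The symmetries of the Riemann curvature tensor. -/
def IsAlgCurv (A : MultilinearMap ℝ (fun _ : Fin 4 => V) ℝ) : Prop :=
  (∀ x y z w, A ![x, y, z, w] = - A ![y, x, z, w]) ∧
  (∀ x y z w, A ![x, y, z, w] = A ![z, w, x, y]) ∧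
  (∀ x y z w, A ![x, y, z, w] + A ![y, z, x, w] + A ![z, x, y, w] = 0)

/-- The symmetries of the covariant derivative of the Riemann curvature tensor. -/
def IsAlgCovDerivCurv (B : MultilinearMap ℝ (fun _ : Fin 5 => V) ℝ) : Prop :=
  (∀ x y z w v, B ![x, y, z, w, v] = B ![z, w, x, y, v]) ∧
  (∀ x y z w v, B ![x, y, z, w, v] = - B ![y, x, z, w, v]) ∧
  (∀ x y z w v, B ![x, y, z, w, v] + B ![y, z, x, w, v] + B ![z, x, y, w, v] = 0) ∧
  (∀ x y z w v, B ![x, y, z, w, v] + B ![x, y, w, v, z] + B ![x, y, v, z, w] = 0)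

/-- The data `(g, A, A¹, …, Aᵏ)` of a `k`-model on `V`: a bilinear form and, for each `j ≤ k`, a
tensor of rank `4 + j`, the algebraic counterpart of `∇^j R`. -/
structure ModelSpace (k : ℕ) (V : Type) [AddCommGroup V] [Module ℝ V] where
  form : LinearMap.BilinForm ℝ V
  tensor : (j : Fin (k + 1)) → MultilinearMap ℝ (fun _ : Fin (4 + j.val) => V) ℝ

/-- The inner product is symmetric and non-degenerate, `A` is an algebraic curvature tensor, and
`A¹` (if `k ≥ 1`) is an algebraic covariant derivative curvature tensor. -/
structure ModelSpace.IsAlgebraic {k : ℕ} (U : ModelSpace k V) : Prop where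
  symm : ∀ x y, U.form x y = U.form y x
  nondegenerate : U.form.Nondegenerate
  curv : IsAlgCurv (U.tensor ⟨0, Nat.succ_pos k⟩)
  covDerivCurv : ∀ h : 1 < k + 1, IsAlgCovDerivCurv (U.tensor ⟨1, h⟩)

/-- A model is irreducible if it admits no non-trivial decomposition
`V = W₁ ⊕ W₂`, `g = g₁ ⊕ g₂`, `Aʲ = Aʲ₁ ⊕ Aʲ₂`. -/
def ModelSpace.IsIrreducible {k : ℕ} (U : ModelSpace k V) : Prop :=
  Nontrivial V ∧ ∀ W₁ W₂ : Submodule ℝ V, IsCompl W₁ W₂ →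
    (∀ x ∈ W₁, ∀ y ∈ W₂, U.form x y = 0 ∧ U.form y x = 0) →
    (∀ (j : Fin (k + 1)) (v w : Fin (4 + j.val) → V), (∀ a, v a ∈ W₁) → (∀ a, w a ∈ W₂) →
      U.tensor j (v + w) = U.tensor j v + U.tensor j w) →
    W₁ = ⊥ ∨ W₂ = ⊥

variable {ι : Type} [Fintype ι] [DecidableEq ι]

/-- The `k`-model `(T_P ℝ^ι, g_P, R_P, ∇R_P, …, ∇ᵏR_P)`. -/
def tangentModel (g : (ι → ℝ) → Matrix ι ι ℝ) (k : ℕ) (P : ι → ℝ) : ModelSpace k (ι → ℝ) where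
  form := Matrix.toBilin' (g P)
  tensor j := ofComponents (nablaR g j.val P)

/-- `U` is a `k`-model for `(ℝ^ι, g)`: at every point `P` there is a linear isomorphism
`Φ : T_P ℝ^ι → V` that pulls the inner product and the tensors of `U` back to
`g_P, R_P, …, ∇ᵏR_P`. -/
def ModelSpace.IsModelFor {k : ℕ} (U : ModelSpace k V) (g : (ι → ℝ) → Matrix ι ι ℝ) : Prop :=
  U.IsAlgebraic ∧ ∀ P : ι → ℝ, ∃ Φ : (ι → ℝ) ≃ₗ[ℝ] V,
    (∀ x y, U.form (Φ x) (Φ y) = (tangentModel g k P).form x y) ∧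
    ∀ (j : Fin (k + 1)) (v : Fin (4 + j.val) → ι → ℝ),
      U.tensor j (fun a => Φ (v a)) = (tangentModel g k P).tensor j v

/-- `(ℝ^ι, g)` is `k`-curvature homogeneous: it admits a `k`-model. -/
def IsCurvatureHomogeneous (k : ℕ) (g : (ι → ℝ) → Matrix ι ι ℝ) : Prop :=
  ∃ (V : Type) (_ : AddCommGroup V) (_ : Module ℝ V) (U : ModelSpace k V), U.IsModelFor g

end Models

/-- The tuples of indices obtained from `(a, b, c, d)` by the usual `ℤ₂` symmetries of the curvature
tensor (exchange of the first two, of the last two, or of the first and the last pair). -/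
def z2Orbit {ι : Type} (a b c d : ι) : Set (Fin 4 → ι) :=
  {![a, b, c, d], ![b, a, c, d], ![a, b, d, c], ![b, a, d, c],
   ![c, d, a, b], ![d, c, a, b], ![c, d, b, a], ![d, c, b, a]}

/-! ### The manifolds `M_{3,r,ψ}` and the models `U_{3,r}`, `U¹_{3,r}` -/

/-- Indices of the coordinates `(u_1, …, u_r, v_1, …, v_r, x, y)` on `ℝ^{2r+2}` (with `Fin r`
counting from `0`), and of the basis `U_i, V_i, X, Y`. -/
inductive Coord (r : ℕ) : Type
  | u (i : Fin r)
  | v (i : Fin r)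
  | x
  | y
  deriving DecidableEq, Fintype

/-- The index `i` for `1 ≤ i ≤ r - 1`. -/
def lowIdx (r : ℕ) (i : Fin (r - 1)) : Fin r := ⟨i.val, by omega⟩

/-- The index `i + 1` for `1 ≤ i ≤ r - 1`. -/
def nextIdx (r : ℕ) (i : Fin (r - 1)) : Fin r := ⟨i.val + 1, by omega⟩

/-- The index `r` of `u_r`. -/
def lastIdx (r : ℕ) (hr : 2 ≤ r) : Fin r := ⟨r - 1, by omega⟩

section Family

variable (r : ℕ) (hr : 2 ≤ r)

/-- The inner product `g_{3,r}`: `g(X, Y) = 1`, `g(U_i, V_j) = δ_ij`. -/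
def modelForm : Matrix (Coord r) (Coord r) ℝ
  | .x, .y => 1
  | .y, .x => 1
  | .u i, .v j => if i = j then 1 else 0
  | .v i, .u j => if i = j then 1 else 0
  | _, _ => 0

/-- The metric `g_{3,r,ψ}`: `g(∂_x, ∂_y) = 1`, `g(∂_{u_i}, ∂_{v_j}) = δ_ij` and
`g(∂_x, ∂_x) = -2 u_1 v_2 - … - 2 u_{r-1} v_r - 2 ψ(u_r)`. -/
def metric (ψ : ℝ → ℝ) (p : Coord r → ℝ) : Matrix (Coord r) (Coord r) ℝ
  | .x, .x => -2 * ∑ i : Fin (r - 1), p (.u (lowIdx r i)) * p (.v (nextIdx r i))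
      - 2 * ψ (p (.u (lastIdx r hr)))
  | a, b => modelForm r a b

/-- The symmetric form with entries `S(U_r, U_r) = 1` and `S(U_i, V_{i+1}) = 1`. -/
def jacobiForm : Coord r → Coord r → ℝ
  | .u i, .u j => if i = lastIdx r hr ∧ j = lastIdx r hr then 1 else 0
  | .u i, .v j => if i.val + 1 = j.val then 1 else 0
  | .v i, .u j => if j.val + 1 = i.val then 1 else 0
  | _, _ => 0

/-- The symmetric form with the single entry `S(U_r, U_r) = 1`. -/
def jacobiForm₁ : Coord r → Coord r → ℝ
  | .u i, .u j => if i = lastIdx r hr ∧ j = lastIdx r hr then 1 else 0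
  | _, _ => 0

variable {r}

/-- The components of the curvature-like tensor with the entries `A(X, b, c, X) = S(b, c)`, those
that follow from them by the `ℤ₂` symmetries, and no others; `S` is symmetric with `S(X, ·) = 0`. -/
def curvEntries (S : Coord r → Coord r → ℝ) (a b c d : Coord r) : ℝ :=
  (if a = .x ∧ d = .x then S b c else 0) - (if b = .x ∧ d = .x then S a c else 0)
    - (if a = .x ∧ c = .x then S b d else 0) + (if b = .x ∧ c = .x then S a d else 0)

variable (r)

/-- `A_{3,r}`: the entries are `A(X, U_r, U_r, X) = 1` and `A(X, U_i, V_{i+1}, X) = 1`. -/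
def modelA : MultilinearMap ℝ (fun _ : Fin 4 => Coord r → ℝ) ℝ :=
  ofComponents fun s => curvEntries (jacobiForm r hr) (s 0) (s 1) (s 2) (s 3)

/-- `A¹_{3,r}`: the entry is `A¹(X, U_r, U_r, X; U_r) = 1`. -/
def modelA₁ : MultilinearMap ℝ (fun _ : Fin 5 => Coord r → ℝ) ℝ :=
  ofComponents fun s => if s 4 = .u (lastIdx r hr) then
    curvEntries (jacobiForm₁ r hr) (s 0) (s 1) (s 2) (s 3) else 0

/-- The `0`-model space `U_{3,r} = (ℝ^{2r+2}, g_{3,r}, A_{3,r})`. -/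
def modelU : ModelSpace 0 (Coord r → ℝ) where
  form := Matrix.toBilin' (modelForm r)
  tensor
    | ⟨0, _⟩ => modelA r hr

/-- The `1`-model space `U¹_{3,r} = (ℝ^{2r+2}, g_{3,r}, A_{3,r}, A¹_{3,r})`. -/
def modelU₁ : ModelSpace 1 (Coord r → ℝ) where
  form := Matrix.toBilin' (modelForm r)
  tensor
    | ⟨0, _⟩ => modelA r hr
    | ⟨1, _⟩ => modelA₁ r hr

end Family

end CurvHom

end

open CurvHom

/-! The metric is the flat neutral form minus 2F dx², where F = Σ u_i v_{i+1} + ψ(u_r) does not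
involve x or y. Write k* for the coordinate paired with k by the flat form (`Coord.dual`). Up to
symmetry the only possibly non-zero Christoffel symbols are Γ_{xx}^k = ∂_{k*}F and Γ_{xi}^y = -∂_iF.
Their products cancel in the curvature, so R is determined by R(∂_x, b, c, ∂_x) = (Hess F)(b, c).
The connection acts trivially on tensors of this shape (`sum_christoffel_curvEntries`), so ∇R
retains only ψ'''. In ∇²R the connection acts on the fifth slot alone, and the ∂_{u_r}-component
u_{r-1} of ∇_{∂_x}∂_x produces the additional term -ψ''' u_{r-1}.

Geodesics. In the order x, u_1, …, u_r, v_r, …, v_1, y each acceleration involves only earlier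
coordinates and their velocities. For such a triangular system Picard iteration becomes stationary
after finitely many steps, which gives a global smooth flow, and the time-one map is v ↦ v + (terms
in earlier components of v), a triangular diffeomorphism (`exists_smooth_flow`,
`exists_diffeomorph_timeOne`).

Models. Rescaling u_i, v_i, x, y and shearing y by a multiple of x brings g, ψ'' and ψ''' to their
normal forms simultaneously (`exists_frameChange`). A 2-model is impossible: the statement "a vector
annihilating the last slot of ∇R also annihilates the last slot of ∇²R" is linear-algebraic, true at
the origin, and violated by ∂_x where u_{r-1} = 1.

Irreducibility. In a splitting W₁ ⊕ W₂ of g and R one summand, say W₁, contains some e with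
x-component 1. The vanishing of R(e, w, ·, e) for w in W₂ puts w - w_x e into the span of v_1 and y.
This forces w_x = 0, so W₂ lies in that totally isotropic plane; there it is orthogonal to W₁ and to
itself, hence zero (`eq_bot_of_curvForm_splits`). A parallel self-adjoint projection commutes with
the curvature operators, so its range and kernel split g and R at each point; it is therefore 0 or 1
at each point, and constant by continuity.

Symmetric case ψ = t². Now F is quadratic, with Hessian represented by J. Let W'' = -J W start at
the (u, v)-part of P with velocity 0. In terms of q = p - W(x - P_x) and η = y + ⟨W', q⟩ the terms
of g linear in q disappear, and the geodesic symmetry is the reflection of x - P_x, q and η - P_y.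
This yields the explicit formula `reflection`. -/

noncomputable section

namespace CurvHom

/-! ### Smooth dependence of integrals on parameters -/

section ParametricIntegral

universe u

/-- Differentiation under the integral sign gives an integral of the same form with values in `E
→L[ℝ] F`, so the induction runs over all target spaces; the common universe of `E` and `F` keeps
these targets in range. -/
theorem contDiff_nat_integral_param {E : Type u} [NormedAddCommGroup E] [NormedSpace ℝ E]
    [ProperSpace E] (n : ℕ) : ∀ {F : Type u} [NormedAddCommGroup F] [NormedSpace ℝ F]
    {h : E × ℝ → F}, ContDiff ℝ n h → ContDiff ℝ n (fun e => ∫ s in (0 : ℝ)..1, h (e, s)) := by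
  induction n with
  | zero =>
    intro F _ _ h hh
    have hc : Continuous h := hh.continuous
    rw [Nat.cast_zero, contDiff_zero]
    exact intervalIntegral.continuous_parametric_intervalIntegral_of_continuous' (f := fun e s => h (e, s)) hc 0 1
  | succ n ih =>
    intro F _ _ h hh
    have hd : Differentiable ℝ h := hh.differentiable (by positivity)
    have hD : ContDiff ℝ n (fderiv ℝ h) := hh.fderiv_right (by norm_cast)
    have hD' : ContDiff ℝ n (fun e : E × ℝ => (fderiv ℝ h e).comp (ContinuousLinearMap.inl ℝ E ℝ)) :=
      hD.clm_comp contDiff_const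
    have hc : Continuous h := hh.continuous
    have hDc := hD'.continuous
    push_cast
    rw [contDiff_succ_iff_hasFDerivAt]
    refine ⟨fun e => ∫ s in (0 : ℝ)..1, (fderiv ℝ h (e, s)).comp (ContinuousLinearMap.inl ℝ E ℝ),
      ih hD', fun e => ?_⟩
    -- `E` is proper, so the derivative is bounded on a compact ball times [0, 1]; the constant is
    -- the dominating function.
    obtain ⟨C, hC⟩ := ((isCompact_closedBall e 1).prod (isCompact_Icc (a := (0:ℝ)) (b := 1))).exists_bound_of_continuousOn
      hDc.continuousOn
    refine intervalIntegral.hasFDerivAt_integral_of_dominated_of_fderiv_le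
      (𝕜 := ℝ) (F := fun e s => h (e, s))
      (F' := fun e s => (fderiv ℝ h (e, s)).comp (ContinuousLinearMap.inl ℝ E ℝ)) (bound := fun _ => C) (Metric.closedBall_mem_nhds e one_pos)
      ?_ ?_ ?_ ?_ ?_ ?_
    · refine Filter.Eventually.of_forall fun x => Continuous.aestronglyMeasurable ?_
      fun_prop
    · apply Continuous.intervalIntegrable
      fun_prop
    · have : SecondCountableTopologyEither ℝ (E →L[ℝ] F) := ⟨Or.inl inferInstance⟩
      refine Continuous.aestronglyMeasurable ?_
      exact hDc.comp (by fun_prop : Continuous fun s : ℝ => (e, s))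
    · refine Filter.Eventually.of_forall fun s hs x hx => ?_
      rw [Set.uIoc_of_le zero_le_one] at hs
      exact hC (x, s) ⟨hx, hs.1.le, hs.2⟩
    · simp
    · refine Filter.Eventually.of_forall fun s hs x hx => ?_
      exact (hd (x, s)).hasFDerivAt.comp x (hasFDerivAt_prodMk_left x s)

theorem contDiff_integral_param {E F : Type u} [NormedAddCommGroup E] [NormedSpace ℝ E]
    [ProperSpace E] [NormedAddCommGroup F] [NormedSpace ℝ F]
    {h : E × ℝ → F} (hh : ContDiff ℝ ∞ h) :
    ContDiff ℝ ∞ (fun e => ∫ s in (0 : ℝ)..1, h (e, s)) :=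
  contDiff_infty.2 fun n => contDiff_nat_integral_param n (contDiff_infty.1 hh n)

/-- The substitution `s ↦ e.2 * s` moves the variable endpoint into the integrand. -/
theorem contDiff_primitive_param {E : Type} [NormedAddCommGroup E] [NormedSpace ℝ E]
    [ProperSpace E] {h : E × ℝ → ℝ} (hh : ContDiff ℝ ∞ h) :
    ContDiff ℝ ∞ (fun e : E × ℝ => ∫ s in (0 : ℝ)..e.2, h (e.1, s)) := by
  have h1 : (fun e : E × ℝ => ∫ s in (0 : ℝ)..e.2, h (e.1, s)) =
      fun e : E × ℝ => e.2 • ∫ s in (0 : ℝ)..1, h (e.1, e.2 * s) := by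
    funext e
    rw [intervalIntegral.smul_integral_comp_mul_left (fun s => h (e.1, s))]
    simp
  rw [h1]
  refine contDiff_snd.smul (contDiff_integral_param (h := fun q : (E × ℝ) × ℝ =>
    h (q.1.1, q.1.2 * q.2)) ?_)
  exact hh.comp (by fun_prop)

theorem hasDerivAt_primitive_param {E : Type} [NormedAddCommGroup E] [NormedSpace ℝ E]
    {h : E × ℝ → ℝ} (hh : Continuous h) (e : E) (t : ℝ) :
    HasDerivAt (fun t => ∫ s in (0 : ℝ)..t, h (e, s)) (h (e, t)) t :=
  intervalIntegral.integral_hasDerivAt_right (Continuous.intervalIntegrable (by fun_prop) _ _)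
    (Continuous.stronglyMeasurableAtFilter (by fun_prop) _ _) (by fun_prop)

end ParametricIntegral

/-! ### Second-order systems with triangular acceleration -/

section TriangularSystem

variable {ι : Type}

/-- Each component of the acceleration field `f` depends only on the positions and velocities
of the coordinates of smaller rank. -/
def IsTriangular (rank : ι → ℕ) (f : ι → (ι → ℝ) × (ι → ℝ) → ℝ) : Prop :=
  ∀ k z w, (∀ j, rank j < rank k → z.1 j = w.1 j ∧ z.2 j = w.2 j) → f k z = f k w

/-- `γ` solves `γ'' = f (γ, γ')` on `s`. -/
def IsSolutionOn [Fintype ι] (f : ι → (ι → ℝ) × (ι → ℝ) → ℝ) (γ : ℝ → ι → ℝ) (s : Set ℝ) : Prop :=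
  ContDiffOn ℝ 2 γ s ∧ ∀ t ∈ s, ∀ k, deriv (deriv γ) t k = f k (γ t, deriv γ t)

/-- Picard iteration for `γ'' = f (γ, γ')`, `γ 0 = P`, `γ' 0 = e.1`, at time `e.2`: position and
velocity. -/
def picard (f : ι → (ι → ℝ) × (ι → ℝ) → ℝ) (P : ι → ℝ) :
    ℕ → (ι → ℝ) × ℝ → (ι → ℝ) × (ι → ℝ)
  | 0 => fun _ => 0
  | m + 1 => fun e =>
    (fun k => P k + ∫ s in (0 : ℝ)..e.2, (e.1 k + ∫ a in (0 : ℝ)..s, f k (picard f P m (e.1, a))),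
      fun k => e.1 k + ∫ s in (0 : ℝ)..e.2, f k (picard f P m (e.1, s)))

variable {rank : ι → ℕ} {f : ι → (ι → ℝ) × (ι → ℝ) → ℝ}

theorem contDiff_picard [Fintype ι] (hf : ∀ k, ContDiff ℝ ∞ (f k)) (P : ι → ℝ) (m : ℕ) :
    ContDiff ℝ ∞ (picard f P m) := by
  induction m with
  | zero => exact contDiff_const
  | succ m ih =>
    have h2 : ∀ k, ContDiff ℝ ∞ (fun e : (ι → ℝ) × ℝ =>
        e.1 k + ∫ s in (0 : ℝ)..e.2, f k (picard f P m (e.1, s))) := fun k =>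
      ContDiff.add (by fun_prop)
        (contDiff_primitive_param (h := fun e => f k (picard f P m e)) ((hf k).comp ih))
    refine ContDiff.prodMk (contDiff_pi.2 fun k => ?_) (contDiff_pi.2 h2)
    exact contDiff_const.add (contDiff_primitive_param (h2 k))

/-- By triangularity an iteration step makes one more rank stationary, so the iterates are
eventually constant and no convergence argument is needed. -/
theorem picard_succ_eq (hT : IsTriangular rank f) (P : ι → ℝ) (m : ℕ) :
    ∀ k, rank k < m → ∀ e, (picard f P (m + 1) e).1 k = (picard f P m e).1 k ∧
      (picard f P (m + 1) e).2 k = (picard f P m e).2 k := by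
  induction m with
  | zero => intro k hk; omega
  | succ m ih =>
    intro k hk e
    have key : ∀ q, f k (picard f P (m + 1) q) = f k (picard f P m q) := fun q =>
      hT k _ _ fun j hj => ih j (by omega) q
    constructor
    · change P k + ∫ s in (0 : ℝ)..e.2, (e.1 k + ∫ a in (0 : ℝ)..s, f k (picard f P (m + 1) (e.1, a))) = _
      simp only [key]; rfl
    · change e.1 k + ∫ s in (0 : ℝ)..e.2, f k (picard f P (m + 1) (e.1, s)) = _
      simp only [key]; rfl

variable [Fintype ι]

/-- The flow of a smooth triangular system is globally defined and smooth. -/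
theorem exists_smooth_flow (hf : ∀ k, ContDiff ℝ ∞ (f k)) (hT : IsTriangular rank f)
    (P : ι → ℝ) : ∃ Γ : (ι → ℝ) × ℝ → ι → ℝ, ContDiff ℝ ∞ Γ ∧
      ∀ v, IsSolutionOn f (fun t => Γ (v, t)) Set.univ ∧ Γ (v, 0) = P ∧
        deriv (fun t => Γ (v, t)) 0 = v := by
  obtain ⟨N, hN⟩ : ∃ N, ∀ k, rank k < N :=
    ⟨Finset.univ.sup rank + 1, fun k => Nat.lt_succ_of_le (Finset.le_sup (Finset.mem_univ k))⟩
  have hc := contDiff_picard hf P N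
  -- Since `N` exceeds every rank, the `N`-th iterate is an exact fixed point; `hB` and `hA` are the
  -- integral equations that this expresses.
  have hfix : ∀ e, picard f P (N + 1) e = picard f P N e := fun e => Prod.ext
    (funext fun k => (picard_succ_eq hT P N k (hN k) e).1)
    (funext fun k => (picard_succ_eq hT P N k (hN k) e).2)
  have hB : ∀ e k, (picard f P N e).2 k =
      e.1 k + ∫ s in (0 : ℝ)..e.2, f k (picard f P N (e.1, s)) := fun e k => by
    rw [← hfix e]; rfl
  have hA : ∀ e k, (picard f P N e).1 k =
      P k + ∫ s in (0 : ℝ)..e.2, (picard f P N (e.1, s)).2 k := fun e k => by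
    simp only [hB]
    rw [← hfix e]; rfl
  have hΓ : ContDiff ℝ ∞ fun e => (picard f P N e).1 := contDiff_fst.comp hc
  have dA : ∀ v t, HasDerivAt (fun t => (picard f P N (v, t)).1) (picard f P N (v, t)).2 t := by
    intro v t
    rw [hasDerivAt_pi]
    intro k
    simp only [hA]
    refine HasDerivAt.const_add (P k) (hasDerivAt_primitive_param
      (h := fun e => (picard f P N e).2 k) ?_ v t)
    have := hc.continuous
    fun_prop
  have dB : ∀ v t k, HasDerivAt (fun t => (picard f P N (v, t)).2 k)
      (f k (picard f P N (v, t))) t := by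
    intro v t k
    simp only [hB]
    exact HasDerivAt.const_add (v k) (hasDerivAt_primitive_param
      (h := fun e => f k (picard f P N e)) ((hf k).continuous.comp hc.continuous) v t)
  have dA' : ∀ v, deriv (fun t => (picard f P N (v, t)).1) = fun t => (picard f P N (v, t)).2 :=
    fun v => funext fun t => (dA v t).deriv
  refine ⟨fun e => (picard f P N e).1, hΓ, fun v => ⟨⟨?_, fun t _ k => ?_⟩, ?_, ?_⟩⟩
  · have : ContDiff ℝ ∞ fun t : ℝ => (picard f P N (v, t)).1 := hΓ.comp (by fun_prop)
    exact (contDiff_infty.1 this 2).contDiffOn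
  · rw [dA', (hasDerivAt_pi.2 (dB v t)).deriv]
  · funext k; simp [hA]
  · rw [dA']; funext k; simp [hB]

/-- Two functions with the same second derivative on an interval differ by an affine function. -/
theorem eq_affine_of_deriv2_eq {a b a' b' c : ℝ → ℝ} {s : Set ℝ} (hs : IsOpen s)
    (hs' : s.OrdConnected) (ha : ∀ t ∈ s, HasDerivAt a (a' t) t)
    (hb : ∀ t ∈ s, HasDerivAt b (b' t) t) (ha' : ∀ t ∈ s, HasDerivAt a' (c t) t)
    (hb' : ∀ t ∈ s, HasDerivAt b' (c t) t) {t₀ t : ℝ} (h₀ : t₀ ∈ s) (ht : t ∈ s) :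
    a' t - b' t = a' t₀ - b' t₀ ∧
      a t - b t = a t₀ - b t₀ + (t - t₀) * (a' t₀ - b' t₀) := by
  have hp : IsPreconnected s := isPreconnected_iff_ordConnected.2 hs'
  have e1 : ∀ t ∈ s, a' t - b' t = a' t₀ - b' t₀ := by
    intro t ht
    have hd : ∀ t ∈ s, HasDerivAt (fun t => a' t - b' t) 0 t := fun t ht => by
      simpa using! (ha' t ht).sub (hb' t ht)
    exact hs.is_const_of_deriv_eq_zero hp
      (fun t ht => (hd t ht).differentiableAt.differentiableWithinAt)
      (fun t ht => (hd t ht).deriv) ht h₀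
  refine ⟨e1 t ht, ?_⟩
  have hd : ∀ t ∈ s, HasDerivAt (fun t => a t - b t - (t - t₀) * (a' t₀ - b' t₀)) 0 t := by
    intro t ht
    have := ((ha t ht).sub (hb t ht)).sub (((hasDerivAt_id t).sub_const t₀).mul_const
      (a' t₀ - b' t₀))
    rw [e1 t ht] at this
    simpa using! this
  have := hs.is_const_of_deriv_eq_zero hp
      (fun t ht => (hd t ht).differentiableAt.differentiableWithinAt)
      (fun t ht => (hd t ht).deriv) ht h₀
  simp only [sub_self, zero_mul, sub_zero] at this
  linarith

theorem IsSolutionOn.hasDerivAt {γ : ℝ → ι → ℝ} {s : Set ℝ} (hs : IsOpen s)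
    (h : IsSolutionOn f γ s) {t : ℝ} (ht : t ∈ s) (k : ι) :
    HasDerivAt (fun t => γ t k) (deriv γ t k) t ∧
      HasDerivAt (fun t => deriv γ t k) (f k (γ t, deriv γ t)) t := by
  have h1 : DifferentiableAt ℝ γ t :=
    (h.1.differentiableOn (by norm_num)).differentiableAt (hs.mem_nhds ht)
  have h2 : DifferentiableAt ℝ (deriv γ) t := by
    have : ContDiffOn ℝ 1 (deriv γ) s := h.1.deriv_of_isOpen hs (by norm_num)
    exact (this.differentiableOn (by norm_num)).differentiableAt (hs.mem_nhds ht)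
  refine ⟨hasDerivAt_pi.1 h1.hasDerivAt k, ?_⟩
  rw [← h.2 t ht k]
  exact hasDerivAt_pi.1 h2.hasDerivAt k

/-- Solutions of a triangular system whose initial data agree in the coordinates of rank `< m`
agree in these coordinates. -/
theorem IsSolutionOn.eq_of_rank_lt (hT : IsTriangular rank f) {γ σ : ℝ → ι → ℝ} {s : Set ℝ}
    (hs : IsOpen s) (hs' : s.OrdConnected) (hγ : IsSolutionOn f γ s) (hσ : IsSolutionOn f σ s)
    {t₀ : ℝ} (h₀ : t₀ ∈ s) (m : ℕ)
    (hi : ∀ k, rank k < m → γ t₀ k = σ t₀ k ∧ deriv γ t₀ k = deriv σ t₀ k) :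
    ∀ k, rank k < m → ∀ t ∈ s, γ t k = σ t k ∧ deriv γ t k = deriv σ t k := by
  induction m with
  | zero => intro k hk; omega
  | succ m ih =>
    intro k hk t ht
    have ih' := ih fun j hj => hi j (by omega)
    -- The lower coordinates already agree, so the `k`-components have the same second derivative
    -- and differ by an affine function, which the initial data annihilate.
    have hf : ∀ t ∈ s, f k (σ t, deriv σ t) = f k (γ t, deriv γ t) := fun t ht =>
      hT k _ _ fun j hj => ⟨(ih' j (by omega) t ht).1.symm, (ih' j (by omega) t ht).2.symm⟩
    obtain ⟨e1, e2⟩ := eq_affine_of_deriv2_eq (c := fun t => f k (γ t, deriv γ t)) hs hs'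
      (fun t ht => (hγ.hasDerivAt hs ht k).1) (fun t ht => (hσ.hasDerivAt hs ht k).1)
      (fun t ht => (hγ.hasDerivAt hs ht k).2)
      (fun t ht => hf t ht ▸ (hσ.hasDerivAt hs ht k).2) h₀ ht
    rw [(hi k hk).2, sub_self] at e1 e2
    rw [(hi k hk).1] at e2
    exact ⟨by linarith, by linarith⟩

theorem IsSolutionOn.unique (hT : IsTriangular rank f) {γ σ : ℝ → ι → ℝ} {s : Set ℝ}
    (hs : IsOpen s) (hs' : s.OrdConnected) (hγ : IsSolutionOn f γ s) (hσ : IsSolutionOn f σ s)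
    {t₀ : ℝ} (h₀ : t₀ ∈ s) (h1 : γ t₀ = σ t₀) (h2 : deriv γ t₀ = deriv σ t₀) :
    Set.EqOn γ σ s := by
  intro t ht
  funext k
  exact (hγ.eq_of_rank_lt hT hs hs' hσ h₀ (rank k + 1)
    (fun k _ => ⟨congrFun h1 k, congrFun h2 k⟩) k (by omega) t ht).1

theorem IsSolutionOn.mono {γ : ℝ → ι → ℝ} {s t : Set ℝ} (h : IsSolutionOn f γ s) (hts : t ⊆ s) :
    IsSolutionOn f γ t := ⟨h.1.mono hts, fun a ha => h.2 a (hts ha)⟩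

theorem IsSolutionOn.comp_sub_const {γ : ℝ → ι → ℝ} (h : IsSolutionOn f γ Set.univ) (a : ℝ) :
    IsSolutionOn f (fun t => γ (t - a)) Set.univ := by
  have e : deriv (fun t => γ (t - a)) = fun t => deriv γ (t - a) :=
    funext fun t => deriv_comp_sub_const _ _ _
  refine ⟨((contDiffOn_univ.1 h.1).comp (by fun_prop)).contDiffOn, fun t _ k => ?_⟩
  rw [e, deriv_comp_sub_const]
  exact h.2 (t - a) trivial k

/-- Every solution of a triangular system extends to all of `ℝ`. -/
theorem IsSolutionOn.exists_extension (hf : ∀ k, ContDiff ℝ ∞ (f k)) (hT : IsTriangular rank f)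
    {γ : ℝ → ι → ℝ} {s : Set ℝ} (hs : IsOpen s) (hs' : s.OrdConnected)
    (hγ : IsSolutionOn f γ s) :
    ∃ σ : ℝ → ι → ℝ, IsSolutionOn f σ Set.univ ∧ Set.EqOn σ γ s := by
  rcases s.eq_empty_or_nonempty with rfl | ⟨t₀, h₀⟩
  · obtain ⟨Γ, -, h⟩ := exists_smooth_flow hf hT 0
    exact ⟨_, (h 0).1, Set.eqOn_empty _ _⟩
  -- The system is autonomous: the extension is the global solution with the data of `γ` at `t₀`,
  -- translated in time by `t₀`.
  · obtain ⟨Γ, -, h⟩ := exists_smooth_flow hf hT (γ t₀)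
    obtain ⟨h1, h2, h3⟩ := h (deriv γ t₀)
    have h4 := h1.comp_sub_const t₀
    refine ⟨_, h4, (h4.mono (Set.subset_univ _)).unique hT hs hs' hγ h₀ ?_ ?_⟩
    · simpa using h2
    · rw [deriv_comp_sub_const (f := fun t => Γ (deriv γ t₀, t))]
      simpa using h3

/-- A map `v ↦ v + G v`, where each component of `G` depends only on the coordinates of smaller
rank, is a diffeomorphism. -/
theorem exists_diffeomorph_of_triangular {Φ : (ι → ℝ) → ι → ℝ} (hΦ : ContDiff ℝ ∞ Φ)
    (hT : ∀ k v w, (∀ j, rank j < rank k → v j = w j) → Φ v k - v k = Φ w k - w k) :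
    ∃ D : Diffeomorph 𝓘(ℝ, ι → ℝ) 𝓘(ℝ, ι → ℝ) (ι → ℝ) (ι → ℝ) ∞, ∀ v, D v = Φ v := by
  obtain ⟨N, hN⟩ : ∃ N, ∀ k, rank k < N :=
    ⟨Finset.univ.sup rank + 1, fun k => Nat.lt_succ_of_le (Finset.le_sup (Finset.mem_univ k))⟩
  -- Φ v = Q means v = Q - (Φ v - v), a fixed-point equation whose right side is triangular. Its
  -- iterates from 0 stabilize rank by rank, and each depends smoothly on Q.
  let T : (ι → ℝ) → (ι → ℝ) → (ι → ℝ) := fun Q v => Q - (Φ v - v)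
  let Ψ : ℕ → (ι → ℝ) → (ι → ℝ) := fun m Q => (T Q)^[m] 0
  have hΨ : ∀ m, ContDiff ℝ ∞ (Ψ m) := by
    intro m
    induction m with
    | zero => exact contDiff_const
    | succ m ih =>
      have : Ψ (m + 1) = fun Q => Q - (Φ (Ψ m Q) - Ψ m Q) := by
        funext Q; simp only [Ψ, Function.iterate_succ_apply']; rfl
      rw [this]
      exact contDiff_id.sub ((hΦ.comp ih).sub ih)
  have hleft : ∀ m v k, rank k < m → Ψ m (Φ v) k = v k := by
    intro m
    induction m with
    | zero => intro v k hk; omega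
    | succ m ih =>
      intro v k hk
      have h1 := hT k (Ψ m (Φ v)) v fun j hj => ih v j (by omega)
      have h2 : Ψ (m + 1) (Φ v) k = Φ v k - (Φ (Ψ m (Φ v)) k - Ψ m (Φ v) k) := by
        simp only [Ψ, Function.iterate_succ_apply']; rfl
      rw [h2]; linarith
  have hstab : ∀ m Q k, rank k < m → Ψ (m + 1) Q k = Ψ m Q k := by
    intro m
    induction m with
    | zero => intro Q k hk; omega
    | succ m ih =>
      intro Q k hk
      have h1 := hT k (Ψ (m + 1) Q) (Ψ m Q) fun j hj => ih Q j (by omega)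
      have h2 : ∀ m, Ψ (m + 1) Q k = Q k - (Φ (Ψ m Q) k - Ψ m Q k) := fun m => by
        simp only [Ψ, Function.iterate_succ_apply']; rfl
      have h3 := h2 (m + 1)
      have h4 := h2 m
      linarith
  have hright : ∀ Q, Φ (Ψ N Q) = Q := by
    intro Q
    funext k
    have h1 := hstab N Q k (hN k)
    have h2 : Ψ (N + 1) Q k = Q k - (Φ (Ψ N Q) k - Ψ N Q k) := by
      simp only [Ψ, Function.iterate_succ_apply']; rfl
    linarith
  exact ⟨{ toFun := Φ
           invFun := Ψ N
           left_inv := fun v => funext fun k => hleft N v k (hN k)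
           right_inv := hright
           contMDiff_toFun := hΦ.contMDiff
           contMDiff_invFun := (hΨ N).contMDiff }, fun v => rfl⟩

/-- The time-one map of a triangular system is a diffeomorphism in the initial velocity, and its
values are those of arbitrary solutions. -/
theorem exists_diffeomorph_timeOne (hf : ∀ k, ContDiff ℝ ∞ (f k)) (hT : IsTriangular rank f)
    (P : ι → ℝ) : ∃ D : Diffeomorph 𝓘(ℝ, ι → ℝ) 𝓘(ℝ, ι → ℝ) (ι → ℝ) (ι → ℝ) ∞,
      ∀ v Q, (∃ (s : Set ℝ) (γ : ℝ → ι → ℝ), IsOpen s ∧ s.OrdConnected ∧ Set.Icc 0 1 ⊆ s ∧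
        IsSolutionOn f γ s ∧ γ 0 = P ∧ deriv γ 0 = v ∧ γ 1 = Q) ↔ D v = Q := by
  obtain ⟨Γ, hΓ, h⟩ := exists_smooth_flow hf hT P
  obtain ⟨D, hD⟩ := exists_diffeomorph_of_triangular (rank := rank) (Φ := fun v => Γ (v, 1))
    (hΓ.comp (by fun_prop)) (by
      intro k v w hvw
      -- If `v` and `w` agree below rank `k`, so do the two solutions. Their `k`-components then
      -- have equal accelerations and equal starting points, and differ by t (v_k - w_k), which is
      -- v_k - w_k at t = 1.
      have hlow := (h v).1.eq_of_rank_lt hT isOpen_univ Set.ordConnected_univ (h w).1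
        (Set.mem_univ 0) (rank k) (fun j hj => by
          rw [(h v).2.1, (h w).2.1, (h v).2.2, (h w).2.2]
          exact ⟨rfl, hvw j hj⟩)
      have hd := fun u (t : ℝ) => (h u).1.hasDerivAt isOpen_univ (Set.mem_univ t) k
      have hfe : ∀ t ∈ Set.univ, f k (Γ (w, t), deriv (fun t => Γ (w, t)) t) =
          f k (Γ (v, t), deriv (fun t => Γ (v, t)) t) := fun t ht =>
        hT k _ _ fun j hj => ⟨(hlow j hj t ht).1.symm, (hlow j hj t ht).2.symm⟩
      have e := (eq_affine_of_deriv2_eq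
        (c := fun t => f k (Γ (v, t), deriv (fun t => Γ (v, t)) t)) isOpen_univ
        Set.ordConnected_univ (fun t _ => (hd v t).1) (fun t _ => (hd w t).1)
        (fun t _ => (hd v t).2) (fun t ht => hfe t ht ▸ (hd w t).2)
        (Set.mem_univ 0) (Set.mem_univ 1)).2
      rw [(h v).2.1, (h w).2.1, (h v).2.2, (h w).2.2] at e
      linarith)
  refine ⟨D, fun v Q => ?_⟩
  rw [hD]
  constructor
  · rintro ⟨s, γ, hs, hs', h01, hγ, h0, h1, rfl⟩
    refine ((h v).1.mono (Set.subset_univ s)).unique hT hs hs' hγ (h01 ⟨le_rfl, zero_le_one⟩)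
      ?_ ?_ (h01 ⟨zero_le_one, le_rfl⟩)
    · rw [(h v).2.1, h0]
    · rw [(h v).2.2, h1]
  · intro hQ
    exact ⟨Set.univ, fun t => Γ (v, t), isOpen_univ, Set.ordConnected_univ, Set.subset_univ _,
      (h v).1, (h v).2.1, (h v).2.2, hQ⟩

end TriangularSystem

/-! ### Rules for partial derivatives -/

section PartialDerivatives

variable {ι : Type} [DecidableEq ι]

theorem pd_const (c : ℝ) (i : ι) (p : ι → ℝ) : pd (fun _ => c) i p = 0 := by
  simp [pd]

variable [Fintype ι]

theorem pd_const_mul {f : (ι → ℝ) → ℝ} {p : ι → ℝ} (hf : DifferentiableAt ℝ f p) (c : ℝ) (i : ι) :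
    pd (fun q => c * f q) i p = c * pd f i p := by
  simp only [pd]
  rw [fderiv_const_mul hf]
  simp

theorem pd_add {f g : (ι → ℝ) → ℝ} {p : ι → ℝ} (hf : DifferentiableAt ℝ f p)
    (hg : DifferentiableAt ℝ g p) (i : ι) :
    pd (fun q => f q + g q) i p = pd f i p + pd g i p := by
  simp only [pd]
  rw [fderiv_fun_add hf hg]
  simp

theorem pd_sub {f g : (ι → ℝ) → ℝ} {p : ι → ℝ} (hf : DifferentiableAt ℝ f p)
    (hg : DifferentiableAt ℝ g p) (i : ι) :
    pd (fun q => f q - g q) i p = pd f i p - pd g i p := by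
  simp only [pd]
  rw [fderiv_fun_sub hf hg]
  simp

theorem pd_mul {f g : (ι → ℝ) → ℝ} {p : ι → ℝ} (hf : DifferentiableAt ℝ f p)
    (hg : DifferentiableAt ℝ g p) (i : ι) :
    pd (fun q => f q * g q) i p = f p * pd g i p + g p * pd f i p := by
  simp only [pd]
  rw [fderiv_fun_mul hf hg]
  simp

theorem pd_sum {κ : Type} {s : Finset κ} {f : κ → (ι → ℝ) → ℝ} {p : ι → ℝ}
    (hf : ∀ k ∈ s, DifferentiableAt ℝ (f k) p) (i : ι) :
    pd (fun q => ∑ k ∈ s, f k q) i p = ∑ k ∈ s, pd (f k) i p := by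
  simp only [pd]
  rw [fderiv_fun_sum hf]
  simp

theorem pd_comp_coord {φ : ℝ → ℝ} {p : ι → ℝ} {a : ι} (hφ : DifferentiableAt ℝ φ (p a)) (i : ι) :
    pd (fun q => φ (q a)) i p = (if i = a then 1 else 0) * deriv φ (p a) := by
  have h := hφ.hasDerivAt.comp_hasFDerivAt p (hasFDerivAt_apply (𝕜 := ℝ) a p)
  have h2 : pd (fun q => φ (q a)) i p =
      (deriv φ (p a) • (ContinuousLinearMap.proj a : (ι → ℝ) →L[ℝ] ℝ)) (Pi.single i 1) := by
    rw [pd, ← h.fderiv]; rfl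
  rw [h2]
  simp [Pi.single_apply, eq_comm]

theorem pd_coord (p : ι → ℝ) (a i : ι) : pd (fun q => q a) i p = if i = a then 1 else 0 := by
  simpa using pd_comp_coord (φ := id) (p := p) (a := a) differentiableAt_id i

end PartialDerivatives

/-! ### Index calculus on the coordinates -/

section Coordinates

variable {r : ℕ}

/-- The coordinates as a disjoint union. -/
def Coord.equivSum (r : ℕ) : Coord r ≃ (Fin r ⊕ Fin r) ⊕ Bool where
  toFun
    | .u i => .inl (.inl i)
    | .v i => .inl (.inr i)
    | .x => .inr true
    | .y => .inr false
  invFun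
    | .inl (.inl i) => .u i
    | .inl (.inr i) => .v i
    | .inr true => .x
    | .inr false => .y
  left_inv a := by cases a <;> rfl
  right_inv a := by rcases a with (_ | _) | (_ | _) <;> rfl

theorem Coord.sum_eq {M : Type*} [AddCommMonoid M] (f : Coord r → M) :
    ∑ a, f a = ∑ i, f (.u i) + ∑ i, f (.v i) + (f .x + f .y) := by
  rw [← (Coord.equivSum r).symm.sum_comp]
  simp [Fintype.sum_sum_type, Coord.equivSum]

/-- The involution that exchanges `u_i` with `v_i` and `x` with `y`. -/
def Coord.dual : Coord r → Coord r
  | .u i => .v i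
  | .v i => .u i
  | .x => .y
  | .y => .x

@[simp] theorem Coord.dual_u (i : Fin r) : (Coord.u i).dual = .v i := rfl
@[simp] theorem Coord.dual_v (i : Fin r) : (Coord.v i).dual = .u i := rfl
@[simp] theorem Coord.dual_x : (Coord.x : Coord r).dual = .y := rfl
@[simp] theorem Coord.dual_y : (Coord.y : Coord r).dual = .x := rfl

@[simp] theorem Coord.dual_dual (a : Coord r) : a.dual.dual = a := by cases a <;> rfl

theorem Coord.eq_dual_comm {a b : Coord r} : b = a.dual ↔ a = b.dual :=
  ⟨fun h => by rw [h, dual_dual], fun h => by rw [h, dual_dual]⟩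

/-- The indicator of the coordinate `x`. -/
def xi (a : Coord r) : ℝ := if a = .x then 1 else 0

@[simp] theorem xi_u (i : Fin r) : xi (.u i) = 0 := rfl
@[simp] theorem xi_v (i : Fin r) : xi (.v i) = 0 := rfl
@[simp] theorem xi_x : xi (.x : Coord r) = 1 := rfl
@[simp] theorem xi_y : xi (.y : Coord r) = 0 := rfl

/-- The indicator of the coordinate `u_r`. -/
def lastInd (hr : 2 ≤ r) (a : Coord r) : ℝ := if a = .u (lastIdx r hr) then 1 else 0

@[simp] theorem lastInd_v (hr : 2 ≤ r) (i : Fin r) : lastInd hr (.v i) = 0 := rfl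
@[simp] theorem lastInd_x (hr : 2 ≤ r) : lastInd hr .x = 0 := rfl
@[simp] theorem lastInd_y (hr : 2 ≤ r) : lastInd hr .y = 0 := rfl
@[simp] theorem lastInd_last (hr : 2 ≤ r) : lastInd hr (.u (lastIdx r hr)) = 1 := if_pos rfl

/-- The symmetric form with entries `S(U_i, V_{i+1}) = 1`. -/
def shiftForm : Coord r → Coord r → ℝ
  | .u i, .v j => if i.val + 1 = j.val then 1 else 0
  | .v i, .u j => if j.val + 1 = i.val then 1 else 0
  | _, _ => 0

theorem shiftForm_comm (a b : Coord r) : shiftForm a b = shiftForm b a := by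
  cases a <;> cases b <;> rfl

@[simp] theorem shiftForm_x_left (a : Coord r) : shiftForm .x a = 0 := by cases a <;> rfl
@[simp] theorem shiftForm_y_left (a : Coord r) : shiftForm .y a = 0 := by cases a <;> rfl
@[simp] theorem shiftForm_x_right (a : Coord r) : shiftForm a .x = 0 := by cases a <;> rfl
@[simp] theorem shiftForm_y_right (a : Coord r) : shiftForm a .y = 0 := by cases a <;> rfl

theorem jacobiForm₁_eq (hr : 2 ≤ r) (a b : Coord r) :
    jacobiForm₁ r hr a b = lastInd hr a * lastInd hr b := by
  cases a <;> cases b <;> simp [jacobiForm₁, lastInd, ite_and]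
  split_ifs <;> rfl

/-- With indicators in place of case distinctions, identities between components become polynomial
identities. -/
theorem curvEntries_eq (S : Coord r → Coord r → ℝ) (a b c d : Coord r) :
    curvEntries S a b c d = xi a * xi d * S b c - xi b * xi d * S a c - xi a * xi c * S b d +
      xi b * xi c * S a d := by
  simp only [curvEntries, xi, ite_and]
  split_ifs <;> ring

/-- The Hessian form with entries `S(U_i, V_{i+1}) = 1` and `S(U_r, U_r) = c`. -/
def hessForm (hr : 2 ≤ r) (c : ℝ) (a b : Coord r) : ℝ :=
  shiftForm a b + c * (lastInd hr a * lastInd hr b)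

theorem jacobiForm_eq (hr : 2 ≤ r) : jacobiForm r hr = hessForm hr 1 := by
  funext a b
  cases a <;> cases b <;> simp [jacobiForm, hessForm, shiftForm, lastInd, ite_and]
  split_ifs <;> rfl

theorem hessForm_comm (hr : 2 ≤ r) (c : ℝ) (a b : Coord r) :
    hessForm hr c a b = hessForm hr c b a := by
  simp only [hessForm, shiftForm_comm a b]; ring

@[simp] theorem hessForm_x_left (hr : 2 ≤ r) (c : ℝ) (a : Coord r) : hessForm hr c .x a = 0 := by
  simp [hessForm]
@[simp] theorem hessForm_y_left (hr : 2 ≤ r) (c : ℝ) (a : Coord r) : hessForm hr c .y a = 0 := by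
  simp [hessForm]

@[simp] theorem hessForm_x_right (hr : 2 ≤ r) (c : ℝ) (a : Coord r) : hessForm hr c a .x = 0 := by
  simp [hessForm]
@[simp] theorem hessForm_y_right (hr : 2 ≤ r) (c : ℝ) (a : Coord r) : hessForm hr c a .y = 0 := by
  simp [hessForm]

theorem modelForm_eq (a b : Coord r) : modelForm r a b = if b = a.dual then 1 else 0 := by
  cases a <;> cases b <;> simp [modelForm, eq_comm]

theorem sum_shift (g : Fin r → Fin r → ℝ) :
    ∑ i : Fin (r - 1), g (lowIdx r i) (nextIdx r i) =
      ∑ i : Fin r, ∑ j : Fin r, (if i.val + 1 = j.val then g i j else 0) := by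
  cases r with
  | zero => rfl
  | succ n =>
    rw [Fin.sum_univ_castSucc]
    have h1 : ∀ i : Fin n, (∑ j : Fin (n + 1),
        if i.castSucc.val + 1 = j.val then g i.castSucc j else 0) = g i.castSucc i.succ := by
      intro i
      rw [Finset.sum_eq_single i.succ]
      · simp
      · intro j _ hj
        rw [if_neg]
        intro h; apply hj; ext; simp at h ⊢; omega
      · simp
    -- The last index has no successor, so its row contributes nothing.
    have h2 : (∑ j : Fin (n + 1),
        if (Fin.last n).val + 1 = j.val then g (Fin.last n) j else 0) = 0 :=
      Finset.sum_eq_zero fun j _ => if_neg (by have := j.isLt; simp; omega)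
    rw [h2, add_zero]
    simp only [h1]
    rfl

end Coordinates

/-! ### The potential F, its gradient and its Hessian -/

section Potential

variable {r : ℕ} (hr : 2 ≤ r) (ψ : ℝ → ℝ)

/-- The function `F` with `g(∂_x, ∂_x) = -2 F`. -/
def potential (p : Coord r → ℝ) : ℝ :=
  (1 / 2) * ∑ a, ∑ b, shiftForm a b * (p a * p b) + ψ (p (.u (lastIdx r hr)))

/-- The gradient of the potential. -/
def grad (a : Coord r) (p : Coord r → ℝ) : ℝ :=
  ∑ b, shiftForm a b * p b + lastInd hr a * iteratedDeriv 1 ψ (p (.u (lastIdx r hr)))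

@[simp] theorem grad_x (p : Coord r → ℝ) : grad hr ψ .x p = 0 := by simp [grad]
@[simp] theorem grad_y (p : Coord r → ℝ) : grad hr ψ .y p = 0 := by simp [grad]

/-- This is the ∂_{u_r}-component of ∇_{∂_x}∂_x, the quantity that obstructs 2-curvature
homogeneity. The coordinate is u_{r-1}, with indices counted from 0. -/
theorem grad_v_last (p : Coord r → ℝ) :
    grad hr ψ (.v (lastIdx r hr)) p = p (.u ⟨r - 2, by omega⟩) := by
  simp only [grad, Coord.sum_eq, shiftForm, lastInd_v]
  rw [Finset.sum_eq_single ⟨r - 2, by omega⟩]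
  · rw [if_pos (by simp only [lastIdx]; omega)]; simp
  · intro j _ hj
    rw [if_neg, zero_mul]
    intro h; apply hj; ext; simp [lastIdx] at h ⊢; omega
  · simp

/-- The symmetric form counts every product u_i v_{i+1} twice, which accounts for the factor 1/2 in
`potential`. -/
theorem sum_shiftForm (p : Coord r → ℝ) :
    ∑ a, ∑ b, shiftForm a b * (p a * p b) =
      2 * ∑ i : Fin (r - 1), p (.u (lowIdx r i)) * p (.v (nextIdx r i)) := by
  rw [sum_shift fun i j => p (.u i) * p (.v j)]
  simp only [Coord.sum_eq, shiftForm]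
  have e : ∑ i : Fin r, ∑ j : Fin r,
      (if j.val + 1 = i.val then (1 : ℝ) else 0) * (p (.v i) * p (.u j)) =
      ∑ i : Fin r, ∑ j : Fin r, if i.val + 1 = j.val then p (.u i) * p (.v j) else 0 := by
    rw [Finset.sum_comm]
    simp [mul_comm]
  simp only [zero_mul, Finset.sum_const_zero, add_zero, zero_add, e]
  simp only [ite_mul, one_mul, zero_mul, two_mul]

theorem metric_eq (p : Coord r → ℝ) (a b : Coord r) :
    metric r hr ψ p a b = (if b = a.dual then 1 else 0) - 2 * potential hr ψ p * (xi a * xi b) := by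
  rw [← modelForm_eq, potential, sum_shiftForm]
  cases a <;> cases b <;> simp [metric, modelForm] ; ring

variable {ψ} (hψ : ContDiff ℝ ∞ ψ)
include hψ

theorem contDiff_iteratedDeriv (k : ℕ) : ContDiff ℝ ∞ (iteratedDeriv k ψ) := by
  rw [iteratedDeriv_eq_iterate]
  exact ContDiff.iterate_deriv k hψ

theorem contDiff_potential : ContDiff ℝ ∞ (potential hr ψ) := by
  unfold potential
  fun_prop

theorem contDiff_grad (a : Coord r) : ContDiff ℝ ∞ (grad hr ψ a) := by
  unfold grad
  have := contDiff_iteratedDeriv hψ 1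
  fun_prop

theorem pd_iteratedDeriv (k : ℕ) (i : Coord r) (p : Coord r → ℝ) :
    pd (fun q => iteratedDeriv k ψ (q (.u (lastIdx r hr)))) i p =
      lastInd hr i * iteratedDeriv (k + 1) ψ (p (.u (lastIdx r hr))) := by
  rw [pd_comp_coord ((contDiff_iteratedDeriv hψ k).differentiable (by simp) _), iteratedDeriv_succ]
  rfl

theorem pd_potential (a : Coord r) (p : Coord r → ℝ) :
    pd (potential hr ψ) a p = grad hr ψ a p := by
  have h0 := hψ.differentiable (by simp)
  unfold potential grad
  rw [pd_add (by fun_prop) (by fun_prop), pd_const_mul (by fun_prop)]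
  congr 1
  -- The product rule yields two sums, which coincide by symmetry of the form and so absorb the
  -- factor 1/2.
  · have h1 : ∀ b c : Coord r, pd (fun q => shiftForm b c * (q b * q c)) a p =
        (if a = c then shiftForm b c * p b else 0) + (if a = b then shiftForm b c * p c else 0) := by
      intro b c
      rw [pd_const_mul (by fun_prop), pd_mul (by fun_prop) (by fun_prop), pd_coord, pd_coord]
      split_ifs <;> ring
    rw [pd_sum (fun _ _ => by fun_prop)]
    have h2 : ∀ b : Coord r, pd (fun q => ∑ c, shiftForm b c * (q b * q c)) a p =
        ∑ c, ((if a = c then shiftForm b c * p b else 0) +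
          (if a = b then shiftForm b c * p c else 0)) := fun b => by
      rw [pd_sum (fun _ _ => by fun_prop)]
      exact Finset.sum_congr rfl fun c _ => h1 b c
    simp only [h2, Finset.sum_add_distrib]
    rw [Finset.sum_comm (f := fun b c => if a = b then shiftForm b c * p c else 0)]
    simp only [Finset.sum_ite_eq, Finset.mem_univ, if_true]
    simp only [shiftForm_comm _ a]
    ring
  · have := pd_iteratedDeriv hr hψ 0 a p
    simpa using this

theorem pd_grad (a i : Coord r) (p : Coord r → ℝ) :
    pd (grad hr ψ a) i p = hessForm hr (iteratedDeriv 2 ψ (p (.u (lastIdx r hr)))) a i := by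
  have h0 := (contDiff_iteratedDeriv hψ 1).differentiable (by simp)
  unfold grad hessForm
  rw [pd_add (by fun_prop) (by fun_prop), pd_const_mul (by fun_prop), pd_iteratedDeriv hr hψ,
    pd_sum (fun _ _ => by fun_prop)]
  have h1 : ∀ b : Coord r, pd (fun q => shiftForm a b * q b) i p =
      if i = b then shiftForm a b else 0 := fun b => by
    rw [pd_const_mul (by fun_prop), pd_coord]; split_ifs <;> ring
  simp only [h1, Finset.sum_ite_eq, Finset.mem_univ, if_true]
  ring

end Potential

/-! ### Inverse metric, Christoffel symbols and curvature -/

section Connection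

variable {r : ℕ} (hr : 2 ≤ r) (ψ : ℝ → ℝ)

/-- The inverse of the metric. -/
def metricInv (p : Coord r → ℝ) : Matrix (Coord r) (Coord r) ℝ := fun a b =>
  (if b = a.dual then 1 else 0) + 2 * potential hr ψ p * (xi a.dual * xi b.dual)

theorem metric_mul_metricInv (p : Coord r → ℝ) : metric r hr ψ p * metricInv hr ψ p = 1 := by
  ext a b
  rw [Matrix.mul_apply]
  have h : ∀ c, metric r hr ψ p a c * metricInv hr ψ p c b =
      (if c = a.dual then metricInv hr ψ p c b else 0) -
      (if c = .x then 2 * potential hr ψ p * xi a * metricInv hr ψ p c b else 0) := by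
    intro c
    rw [metric_eq]
    simp only [xi]
    split_ifs <;> ring
  simp only [h, Finset.sum_sub_distrib, Finset.sum_ite_eq', Finset.mem_univ, if_true]
  simp only [metricInv, Coord.dual_dual, Matrix.one_apply, Coord.dual_x, xi_y, zero_mul, mul_zero,
    add_zero, eq_comm (a := b)]
  have : xi b.dual = if Coord.y = b then 1 else 0 := by cases b <;> rfl
  rw [this]
  ring

theorem inv_metric (p : Coord r → ℝ) : (metric r hr ψ p)⁻¹ = metricInv hr ψ p :=
  Matrix.inv_eq_right_inv (metric_mul_metricInv hr ψ p)

theorem metric_comm (p : Coord r → ℝ) (a b : Coord r) :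
    metric r hr ψ p a b = metric r hr ψ p b a := by
  have h : (if b = a.dual then (1 : ℝ) else 0) = if a = b.dual then 1 else 0 :=
    if_congr Coord.eq_dual_comm rfl rfl
  rw [metric_eq, metric_eq, h]
  ring

variable {ψ} (hψ : ContDiff ℝ ∞ ψ)
include hψ

theorem isPseudoRiemannian_metric : IsPseudoRiemannian (metric r hr ψ) where
  smooth i j := by
    simp only [metric_eq]
    have := contDiff_potential hr hψ
    fun_prop
  symm p i j := metric_comm hr ψ p i j
  nondegenerate p := Matrix.isUnit_det_of_right_inverse (metric_mul_metricInv hr ψ p)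

theorem pd_metric (p : Coord r → ℝ) (a b i : Coord r) :
    pd (fun q => metric r hr ψ q a b) i p = -2 * (xi a * xi b) * grad hr ψ i p := by
  have h0 := (contDiff_potential hr hψ).differentiable (by simp)
  have h1 : (fun q => metric r hr ψ q a b) = fun q => (if b = a.dual then 1 else 0) -
      (2 * (xi a * xi b)) * potential hr ψ q := funext fun q => by rw [metric_eq]; ring
  rw [h1, pd_sub (by fun_prop) (by fun_prop), pd_const, pd_const_mul (by fun_prop),
    pd_potential hr hψ]
  ring

/-- Beyond the flat pairing the inverse metric has only a (y, y)-entry. It meets the bracket at l =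
y, where every term vanishes because g(∂_y, ·) is constant and F does not depend on y. -/
theorem christoffel_metric (p : Coord r → ℝ) (k i j : Coord r) :
    christoffel (metric r hr ψ) p k i j = xi i * xi j * grad hr ψ k.dual p -
      xi k.dual * (xi j * grad hr ψ i p + xi i * grad hr ψ j p) := by
  unfold christoffel
  simp only [pd_metric hr hψ, inv_metric]
  rw [Finset.sum_eq_single k.dual]
  · have : metricInv hr ψ p k k.dual = 1 := by cases k <;> simp [metricInv]
    rw [this]; ring
  · intro l _ hl
    have : metricInv hr ψ p k l = 2 * potential hr ψ p * (xi k.dual * xi l.dual) := by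
      rw [metricInv, if_neg hl, zero_add]
    rw [this]
    cases l <;> simp
  · simp

theorem pd_christoffel_metric (p : Coord r → ℝ) (k i j m : Coord r) :
    pd (fun q => christoffel (metric r hr ψ) q k i j) m p =
      xi i * xi j * hessForm hr (iteratedDeriv 2 ψ (p (.u (lastIdx r hr)))) k.dual m -
      xi k.dual * (xi j * hessForm hr (iteratedDeriv 2 ψ (p (.u (lastIdx r hr)))) i m +
        xi i * hessForm hr (iteratedDeriv 2 ψ (p (.u (lastIdx r hr)))) j m) := by
  have h0 := fun a => (contDiff_grad hr hψ a).differentiable (by simp)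
  simp only [christoffel_metric hr hψ]
  rw [pd_sub (by fun_prop) (by fun_prop), pd_const_mul (by fun_prop), pd_const_mul (by fun_prop),
    pd_add (by fun_prop) (by fun_prop), pd_const_mul (by fun_prop), pd_const_mul (by fun_prop)]
  simp only [pd_grad hr hψ]

theorem curvatureOp_metric (p : Coord r → ℝ) (i j k l : Coord r) :
    curvatureOp (metric r hr ψ) p i j k l =
      curvEntries (hessForm hr (iteratedDeriv 2 ψ (p (.u (lastIdx r hr))))) i j k l.dual := by
  unfold curvatureOp
  rw [pd_christoffel_metric hr hψ, pd_christoffel_metric hr hψ, Finset.sum_eq_zero]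
  · rw [curvEntries_eq, hessForm_comm hr _ l.dual i, hessForm_comm hr _ j i,
      hessForm_comm hr _ k i, hessForm_comm hr _ l.dual j, hessForm_comm hr _ k j]
    ring
  -- For each `m` separately the quadratic terms vanish or cancel under the exchange of `i` and `j`.
  · intro m _
    simp only [christoffel_metric hr hψ]
    cases m <;> simp <;> ring

theorem riemann_metric (p : Coord r → ℝ) (s : Fin 4 → Coord r) :
    riemann (metric r hr ψ) p s =
      curvEntries (hessForm hr (iteratedDeriv 2 ψ (p (.u (lastIdx r hr)))))
        (s 0) (s 1) (s 2) (s 3) := by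
  unfold riemann
  simp only [curvatureOp_metric hr hψ]
  rw [Finset.sum_eq_single (s 3).dual]
  · rw [metric_eq, Coord.dual_dual, if_pos rfl]
    have : xi (s 3).dual * xi (s 3) = 0 := by cases s 3 <;> simp
    rw [this]; ring
  -- The non-flat part of the metric only lowers the ∂_x-component, and the curvature operators have
  -- no such component.
  · intro m _ hm
    rw [metric_eq, if_neg (fun h => hm (Coord.eq_dual_comm.1 h))]
    cases m <;> simp [curvEntries_eq]
  · simp

end Connection

/-! ### First and second covariant derivatives of the curvature -/

section CovariantDerivatives

variable {r : ℕ} (hr : 2 ≤ r) {ψ : ℝ → ℝ} (hψ : ContDiff ℝ ∞ ψ)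

include hψ

/-- The symbols that do not come from ∇_{∂_x}∂_x have upper index y, and the assumption on φ removes
them. -/
theorem sum_christoffel_mul (p : Coord r → ℝ) (j c : Coord r) (φ : Coord r → ℝ) (h : φ .y = 0) :
    ∑ l, christoffel (metric r hr ψ) p l j c * φ l =
      xi j * xi c * ∑ l, grad hr ψ l.dual p * φ l := by
  rw [Finset.mul_sum]
  refine Finset.sum_congr rfl fun l _ => ?_
  rw [christoffel_metric hr hψ]
  cases l <;> simp [h] <;> ring

/-- The connection acts trivially on curvature-like tensors. -/
theorem sum_christoffel_curvEntries (S : Coord r → Coord r → ℝ) (hS : ∀ a b, S a b = S b a)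
    (hy : ∀ a, S .y a = 0) (p : Coord r → ℝ) (j a b c d : Coord r) :
    ∑ l, christoffel (metric r hr ψ) p l j a * curvEntries S l b c d +
    ∑ l, christoffel (metric r hr ψ) p l j b * curvEntries S a l c d +
    ∑ l, christoffel (metric r hr ψ) p l j c * curvEntries S a b l d +
    ∑ l, christoffel (metric r hr ψ) p l j d * curvEntries S a b c l = 0 := by
  have hy' : ∀ a, S a .y = 0 := fun a => by rw [hS, hy]
  rw [sum_christoffel_mul hr hψ, sum_christoffel_mul hr hψ, sum_christoffel_mul hr hψ,
    sum_christoffel_mul hr hψ]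
  · have key : ∀ l, xi l * grad hr ψ l.dual p = 0 := fun l => by cases l <;> simp
    have h1 : ∀ l, grad hr ψ l.dual p * curvEntries S l b c d =
        xi b * xi c * (grad hr ψ l.dual p * S l d) - xi b * xi d * (grad hr ψ l.dual p * S l c) :=
      fun l => by
        rw [curvEntries_eq]; linear_combination (xi d * S b c - xi c * S b d) * key l
    have h2 : ∀ l, grad hr ψ l.dual p * curvEntries S a l c d =
        xi a * xi d * (grad hr ψ l.dual p * S l c) - xi a * xi c * (grad hr ψ l.dual p * S l d) :=
      fun l => by
        rw [curvEntries_eq]; linear_combination (-xi d * S a c + xi c * S a d) * key l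
    have h3 : ∀ l, grad hr ψ l.dual p * curvEntries S a b l d =
        xi a * xi d * (grad hr ψ l.dual p * S l b) - xi b * xi d * (grad hr ψ l.dual p * S l a) :=
      fun l => by
        rw [curvEntries_eq, hS l a, hS l b]
        linear_combination (-xi a * S b d + xi b * S a d) * key l
    have h4 : ∀ l, grad hr ψ l.dual p * curvEntries S a b c l =
        xi b * xi c * (grad hr ψ l.dual p * S l a) - xi a * xi c * (grad hr ψ l.dual p * S l b) :=
      fun l => by
        rw [curvEntries_eq, hS l a, hS l b]
        linear_combination (xi a * S b c - xi b * S a c) * key l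
    simp only [h1, h2, h3, h4, Finset.sum_sub_distrib, ← Finset.mul_sum]
    ring
  all_goals simp [curvEntries_eq, hy, hy']

theorem covDeriv_riemann_metric (p : Coord r → ℝ) (s : Fin 5 → Coord r) :
    covDeriv (metric r hr ψ) (riemann (metric r hr ψ)) p s =
      iteratedDeriv 3 ψ (p (.u (lastIdx r hr))) * lastInd hr (s 4) *
        curvEntries (jacobiForm₁ r hr) (s 0) (s 1) (s 2) (s 3) := by
  have h0 := (contDiff_iteratedDeriv hψ 2).differentiable (by simp)
  unfold covDeriv
  have h1 : ∀ a b c d : Coord r, (fun q : Coord r → ℝ =>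
      curvEntries (hessForm hr (iteratedDeriv 2 ψ (q (.u (lastIdx r hr))))) a b c d) = fun q =>
      curvEntries shiftForm a b c d +  curvEntries (jacobiForm₁ r hr) a b c d *
        iteratedDeriv 2 ψ (q (.u (lastIdx r hr))) := fun a b c d => funext fun q => by
    simp only [curvEntries_eq, hessForm, jacobiForm₁_eq]; ring
  simp only [riemann_metric hr hψ]
  rw [h1, pd_add (by fun_prop) (by fun_prop), pd_const, pd_const_mul (by fun_prop),
    pd_iteratedDeriv hr hψ]
  have h2 := sum_christoffel_curvEntries hr hψ _
    (hessForm_comm hr (iteratedDeriv 2 ψ (p (.u (lastIdx r hr))))) (hessForm_y_left hr _) p (s 4) (s 0) (s 1) (s 2) (s 3)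
  -- The connection terms agree with `h2` only after `Function.update` is evaluated, so they are
  -- matched by unification instead of rewriting.
  have h3 : ∀ x : ℝ, x = 0 → ∀ y z : ℝ, y = z → y - x = z := by intros; linarith
  rw [Fin.sum_univ_four]
  refine h3 _ h2 _ _ ?_
  rw [zero_add]
  change curvEntries _ (s 0) (s 1) (s 2) (s 3) * (lastInd hr (s 4) * _) = _
  ring

theorem covDeriv₂_riemann_metric (p : Coord r → ℝ) (s : Fin 6 → Coord r) :
    covDeriv (metric r hr ψ) (covDeriv (metric r hr ψ) (riemann (metric r hr ψ))) p s =
      (iteratedDeriv 4 ψ (p (.u (lastIdx r hr))) * lastInd hr (s 4) * lastInd hr (s 5) -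
        iteratedDeriv 3 ψ (p (.u (lastIdx r hr))) * p (.u ⟨r - 2, by omega⟩) *
          (xi (s 4) * xi (s 5))) *
        curvEntries (jacobiForm₁ r hr) (s 0) (s 1) (s 2) (s 3) := by
  have h0 := (contDiff_iteratedDeriv hψ 3).differentiable (by simp)
  rw [covDeriv]
  simp only [covDeriv_riemann_metric hr hψ]
  have h1 : ∀ x y : ℝ, (fun q : Coord r → ℝ =>
      iteratedDeriv 3 ψ (q (.u (lastIdx r hr))) * x * y) = fun q =>
      (x * y) * iteratedDeriv 3 ψ (q (.u (lastIdx r hr))) := fun x y => funext fun q => by ring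
  rw [h1, pd_const_mul (by fun_prop), pd_iteratedDeriv hr hψ, Fin.sum_univ_five]
  have h2 := sum_christoffel_curvEntries hr hψ (jacobiForm₁ r hr)
    (fun a b => by rw [jacobiForm₁_eq, jacobiForm₁_eq]; ring)
    (fun a => by rw [jacobiForm₁_eq]; simp)
    p (s 5) (s 0) (s 1) (s 2) (s 3)
  -- The fifth slot sees only du_r, so of the connection only the u_r-component survives. It is
  -- ∂_{v_r}F = u_{r-1} in the directions x, x, and zero otherwise.
  have h3 : ∑ l, christoffel (metric r hr ψ) p l (s 5) (s 4) *
      (iteratedDeriv 3 ψ (p (.u (lastIdx r hr))) * lastInd hr l *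
        curvEntries (jacobiForm₁ r hr) (s 0) (s 1) (s 2) (s 3)) =
      iteratedDeriv 3 ψ (p (.u (lastIdx r hr))) * p (.u ⟨r - 2, by omega⟩) *
          (xi (s 4) * xi (s 5)) * curvEntries (jacobiForm₁ r hr) (s 0) (s 1) (s 2) (s 3) := by
    rw [Finset.sum_eq_single (.u (lastIdx r hr))]
    · rw [lastInd_last, christoffel_metric hr hψ, Coord.dual_u, xi_v, grad_v_last]; ring
    · intro l _ hl
      rw [lastInd, if_neg hl]; ring
    · simp
  have h4 : ∀ (φ f g : Coord r → ℝ) (c : ℝ), (∀ l, φ l = f l * (c * g l)) →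
      ∑ l, φ l = c * ∑ l, f l * g l := by
    intro φ f g c h
    rw [Finset.mul_sum]
    exact Finset.sum_congr rfl fun l _ => by rw [h]; ring
  -- The `x`s are the connection terms of the five slots. The first four are multiples of the terms
  -- in `h2` by one common factor and cancel; the last is `h3`.
  have h5 : ∀ x0 x1 x2 x3 x4 y0 y1 y2 y3 y4 z c e : ℝ, x0 = c * y0 → x1 = c * y1 → x2 = c * y2 →
      x3 = c * y3 → x4 = y4 → y0 + y1 + y2 + y3 = 0 → z - y4 = e →
      z - (x0 + x1 + x2 + x3 + x4) = e := by
    intro x0 x1 x2 x3 x4 y0 y1 y2 y3 y4 z c e h0 h1 h2 h3 h4 h5 h6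
    linear_combination h6 - h0 - h1 - h2 - h3 - h4 - c * h5
  refine h5 _ _ _ _ _ _ _ _ _ _ _ (iteratedDeriv 3 ψ (p (.u (lastIdx r hr))) * lastInd hr (s 4))
    _ (h4 _ _ _ _ fun l => rfl) (h4 _ _ _ _ fun l => rfl) (h4 _ _ _ _ fun l => rfl)
    (h4 _ _ _ _ fun l => rfl) h3 h2 ?_
  change lastInd hr (s 4) * curvEntries (jacobiForm₁ r hr) (s 0) (s 1) (s 2) (s 3) *
    (lastInd hr (s 5) * _) - _ = _
  ring

end CovariantDerivatives

/-! ### The geodesic equation is triangular -/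

section Geodesics

variable {r : ℕ} (hr : 2 ≤ r) (ψ : ℝ → ℝ)

theorem sum_xi_mul (φ : Coord r → ℝ) : ∑ a, xi a * φ a = φ .x := by
  simp [xi]

/-- The acceleration of a geodesic as a function of its position and velocity. -/
def geodesicField (k : Coord r) (z : (Coord r → ℝ) × (Coord r → ℝ)) : ℝ :=
  -(z.2 .x) ^ 2 * grad hr ψ k.dual z.1 +
    2 * xi k.dual * z.2 .x * ∑ i, grad hr ψ i z.1 * z.2 i

/-- The position of a coordinate in the order `x, u_1, …, u_r, v_r, …, v_1, y`. -/
def Coord.rank : Coord r → ℕ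
  | .x => 0
  | .u i => 1 + i.val
  | .v i => 2 * r - i.val
  | .y => 2 * r + 1

/-- The acceleration of the coordinate a* is driven by ∂_aF. This lemma and the next say that ∂_aF
depends only on coordinates that precede a*, the reason for the order in `Coord.rank`. -/
theorem shiftForm_eq_zero_of_rank_le {a b : Coord r} (h : a.dual.rank ≤ b.rank) :
    shiftForm a b = 0 := by
  cases a <;> cases b <;> simp only [shiftForm, Coord.dual_u, Coord.dual_v, Coord.rank] at h ⊢ <;>
    split_ifs <;> first | rfl | omega

theorem lastInd_eq_zero_of_rank_le {a : Coord r}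
    (h : a.dual.rank ≤ (Coord.u (lastIdx r hr)).rank) : lastInd hr a = 0 := by
  cases a with
  | u i => simp [Coord.rank, lastIdx] at h; omega
  | _ => rfl

theorem grad_congr {a : Coord r} {p q : Coord r → ℝ}
    (h : ∀ b : Coord r, b.rank < a.dual.rank → p b = q b) : grad hr ψ a p = grad hr ψ a q := by
  unfold grad
  congr 1
  · refine Finset.sum_congr rfl fun b _ => ?_
    by_cases hb : b.rank < a.dual.rank
    · rw [h b hb]
    · rw [shiftForm_eq_zero_of_rank_le (not_lt.1 hb), zero_mul, zero_mul]
  · by_cases hb : (Coord.u (lastIdx r hr)).rank < a.dual.rank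
    · rw [h _ hb]
    · rw [lastInd_eq_zero_of_rank_le hr (not_lt.1 hb), zero_mul, zero_mul]

theorem Coord.rank_lt_rank_y {a : Coord r} (ha : a ≠ .y) : a.rank < (Coord.y : Coord r).rank := by
  cases a with
  | y => exact absurd rfl ha
  | _ => simp only [rank]; omega

theorem Coord.rank_x_lt {a : Coord r} (ha : a ≠ .x) : (Coord.x : Coord r).rank < a.rank := by
  cases a with
  | x => exact absurd rfl ha
  | _ => simp only [rank]; omega

theorem isTriangular_geodesicField : IsTriangular Coord.rank (geodesicField hr ψ) := by
  intro k z w h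
  unfold geodesicField
  by_cases hk : k = .x
  · subst hk; simp
  · rw [(h .x (Coord.rank_x_lt hk)).2, grad_congr hr ψ (a := k.dual) (q := w.1)
      fun b hb => (h b (by simpa using hb)).1]
    congr 1
    -- The sum over all velocities occurs only in the equation of the last coordinate y. Its terms i
    -- = x, y, not covered by the order, vanish with the gradient.
    by_cases hy : k = .y
    · subst hy
      congr 1
      refine Finset.sum_congr rfl fun i _ => ?_
      by_cases hi : i = .y
      · subst hi; simp
      by_cases hi' : i = .x
      · subst hi'; simp
      rw [(h i (Coord.rank_lt_rank_y hi)).2, grad_congr hr ψ (q := w.1)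
        fun b hb => (h b (lt_of_lt_of_le hb (Coord.rank_lt_rank_y ?_).le)).1]
      cases i <;> simp_all
    · have : xi k.dual = 0 := by cases k <;> simp_all
      simp [this]

variable {ψ} (hψ : ContDiff ℝ ∞ ψ)
include hψ

theorem contDiff_geodesicField (k : Coord r) : ContDiff ℝ ∞ (geodesicField hr ψ k) := by
  have h := fun a => contDiff_grad hr hψ a
  have h1 : ∀ a, ContDiff ℝ ∞ fun z : (Coord r → ℝ) × (Coord r → ℝ) => grad hr ψ a z.1 :=
    fun a => (h a).comp contDiff_fst
  unfold geodesicField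
  fun_prop

theorem sum_christoffel_eq (z : (Coord r → ℝ) × (Coord r → ℝ)) (k : Coord r) :
    ∑ i, ∑ j, christoffel (metric r hr ψ) z.1 k i j * z.2 i * z.2 j = -geodesicField hr ψ k z := by
  have h1 : ∀ i j, christoffel (metric r hr ψ) z.1 k i j * z.2 i * z.2 j =
      xi i * (xi j * (grad hr ψ k.dual z.1 * z.2 i * z.2 j)) -
      (xi j * (xi k.dual * grad hr ψ i z.1 * z.2 i * z.2 j) +
        xi i * (xi k.dual * grad hr ψ j z.1 * z.2 i * z.2 j)) := fun i j => by
    rw [christoffel_metric hr hψ]; ring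
  simp only [h1, Finset.sum_sub_distrib, Finset.sum_add_distrib, ← Finset.mul_sum, sum_xi_mul]
  have h2 : ∀ i, xi k.dual * grad hr ψ i z.1 * z.2 i * z.2 .x =
      xi k.dual * z.2 .x * (grad hr ψ i z.1 * z.2 i) := fun i => by ring
  have h3 : ∀ i, xi k.dual * grad hr ψ i z.1 * z.2 .x * z.2 i =
      xi k.dual * z.2 .x * (grad hr ψ i z.1 * z.2 i) := fun i => by ring
  simp only [h2, h3, ← Finset.mul_sum, geodesicField]
  ring

theorem isGeodesicOn_iff (γ : ℝ → Coord r → ℝ) (s : Set ℝ) :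
    IsGeodesicOn (metric r hr ψ) γ s ↔ IsSolutionOn (geodesicField hr ψ) γ s := by
  refine and_congr Iff.rfl (forall_congr' fun t => forall_congr' fun _ => forall_congr' fun k => ?_)
  rw [sum_christoffel_eq hr hψ (γ t, deriv γ t) k]
  constructor <;> intro h <;> linarith

theorem isGeodesicallyComplete_metric : IsGeodesicallyComplete (metric r hr ψ) := by
  intro s γ hs hs' hγ
  simp only [isGeodesicOn_iff hr hψ] at hγ ⊢
  exact hγ.exists_extension (contDiff_geodesicField hr hψ) (isTriangular_geodesicField hr ψ) hs hs'

theorem expIsDiffeo_metric (P : Coord r → ℝ) : ExpIsDiffeo (metric r hr ψ) P := by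
  obtain ⟨D, hD⟩ := exists_diffeomorph_timeOne (contDiff_geodesicField hr hψ)
    (isTriangular_geodesicField hr ψ) P
  refine ⟨D, fun v Q => ?_⟩
  simp only [ExpEq, isGeodesicOn_iff hr hψ]
  exact hD v Q

end Geodesics

/-! ### Neutral signature -/

section Signature

variable {r : ℕ} (hr : 2 ≤ r) (ψ : ℝ → ℝ)

theorem toBilin'_metric (p v w : Coord r → ℝ) :
    Matrix.toBilin' (metric r hr ψ p) v w =
      ∑ a, v a * w a.dual - 2 * potential hr ψ p * (v .x * w .x) := by
  rw [Matrix.toBilin'_apply]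
  have h : ∀ a b, v a * metric r hr ψ p a b * w b = (if b = a.dual then v a * w b else 0) -
      xi a * (xi b * (2 * potential hr ψ p * (v a * w b))) := fun a b => by
    rw [metric_eq]; split_ifs <;> ring
  simp only [h, Finset.sum_sub_distrib, ← Finset.mul_sum, sum_xi_mul, Finset.sum_ite_eq',
    Finset.mem_univ, if_true]

theorem toBilin'_metric_comm (p v w : Coord r → ℝ) :
    Matrix.toBilin' (metric r hr ψ p) v w = Matrix.toBilin' (metric r hr ψ p) w v := by
  rw [Matrix.toBilin'_apply, Matrix.toBilin'_apply, Finset.sum_comm]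
  refine Finset.sum_congr rfl fun b _ => Finset.sum_congr rfl fun a _ => ?_
  rw [metric_comm]; ring

/-- A parametrization of a maximal definite subspace, of sign `ε`, of the metric with
`g(∂_x, ∂_x) = -2 f`. -/
def definiteEmbedding (r : ℕ) (f ε : ℝ) : ((Fin r → ℝ) × ℝ) →ₗ[ℝ] (Coord r → ℝ) where
  toFun c
    | .u i => c.1 i
    | .v i => ε * c.1 i
    | .x => c.2
    | .y => (f + ε) * c.2
  map_add' c d := by funext a; cases a <;> simp <;> ring
  map_smul' t c := by funext a; cases a <;> simp <;> ring

theorem definiteEmbedding_injective (f ε : ℝ) : Function.Injective (definiteEmbedding r f ε) := by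
  intro c d h
  exact Prod.ext (funext fun i => congrFun h (.u i)) (congrFun h .x)

theorem finrank_range_definiteEmbedding (f ε : ℝ) :
    Module.finrank ℝ (LinearMap.range (definiteEmbedding r f ε)) = r + 1 := by
  rw [LinearMap.finrank_range_of_inj (definiteEmbedding_injective f ε)]
  simp

theorem toBilin'_definiteEmbedding (p : Coord r → ℝ) (ε : ℝ) (c : (Fin r → ℝ) × ℝ) :
    Matrix.toBilin' (metric r hr ψ p) (definiteEmbedding r (potential hr ψ p) ε c)
      (definiteEmbedding r (potential hr ψ p) ε c) = 2 * ε * (∑ i, c.1 i ^ 2 + c.2 ^ 2) := by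
  rw [toBilin'_metric, Coord.sum_eq]
  have h1 : ∀ i, c.1 i * (ε * c.1 i) = ε * c.1 i ^ 2 := fun i => by ring
  have h2 : ∀ i, ε * c.1 i * c.1 i = ε * c.1 i ^ 2 := fun i => by ring
  simp only [definiteEmbedding, LinearMap.coe_mk, AddHom.coe_mk, Coord.dual_u, Coord.dual_v,
    Coord.dual_x, Coord.dual_y, h1, h2, ← Finset.mul_sum]
  ring

theorem hasSignature_metric (p : Coord r → ℝ) :
    HasSignature (Matrix.toBilin' (metric r hr ψ p)) (r + 1) (r + 1) := by
  set f := potential hr ψ p with hf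
  have hpos : ∀ ε, ∀ x ∈ LinearMap.range (definiteEmbedding r f ε), x ≠ 0 →
      ∃ q : ℝ, 0 < q ∧ Matrix.toBilin' (metric r hr ψ p) x x = 2 * ε * q := by
    rintro ε _ ⟨c, rfl⟩ hc
    refine ⟨_, ?_, toBilin'_definiteEmbedding hr ψ p ε c⟩
    have h0 : 0 ≤ ∑ i, c.1 i ^ 2 := Finset.sum_nonneg fun i _ => sq_nonneg _
    refine lt_of_le_of_ne (by positivity) fun h => hc ?_
    have h1 : ∑ i, c.1 i ^ 2 = 0 := by nlinarith [sq_nonneg c.2]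
    have h2 : c.2 = 0 := by nlinarith [sq_nonneg c.2]
    have h3 : c.1 = 0 := funext fun i => by
      have := (Finset.sum_eq_zero_iff_of_nonneg fun i _ => sq_nonneg (c.1 i)).1 h1 i
        (Finset.mem_univ i)
      simpa using this
    rw [show c = 0 from Prod.ext h3 h2, map_zero]
  have hneg' : ∀ x ∈ LinearMap.range (definiteEmbedding r f (-1)), x ≠ 0 →
      Matrix.toBilin' (metric r hr ψ p) x x < 0 := fun x hx hx0 => by
    obtain ⟨q, hq, h⟩ := hpos _ x hx hx0
    rw [h]; linarith
  have hpos' : ∀ x ∈ LinearMap.range (definiteEmbedding r f 1), x ≠ 0 →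
      0 < Matrix.toBilin' (metric r hr ψ p) x x := fun x hx hx0 => by
    obtain ⟨q, hq, h⟩ := hpos _ x hx hx0
    rw [h]; linarith
  refine ⟨fun x y => toBilin'_metric_comm hr ψ p x y, _, _, ⟨?_, ?_⟩,
    finrank_range_definiteEmbedding f (-1), finrank_range_definiteEmbedding f 1, hneg', hpos'⟩
  · rw [Submodule.disjoint_def]
    intro x h1 h2
    by_contra hx
    exact lt_asymm (hneg' x h1 hx) (hpos' x h2 hx)
  · rw [codisjoint_iff, eq_top_iff]
    intro q _
    -- Half-differences and half-sums of paired coordinates, after the shear y ↦ y - f x that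
    -- removes the (x, x)-entry.
    refine Submodule.mem_sup.2 ⟨_, ⟨(fun i => (q (.u i) - q (.v i)) / 2,
      (q .x - q .y + f * q .x) / 2), rfl⟩, _, ⟨(fun i => (q (.u i) + q (.v i)) / 2,
      (q .x + q .y - f * q .x) / 2), rfl⟩, ?_⟩
    funext a
    cases a <;> simp [definiteEmbedding] <;> ring

end Signature

/-! ### The non-zero components of R and ∇R -/

section Components

variable {r : ℕ} (hr : 2 ≤ r)

theorem mem_z2Orbit_of_curvEntries_ne_zero {S : Coord r → Coord r → ℝ} {s : Fin 4 → Coord r}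
    (h : curvEntries S (s 0) (s 1) (s 2) (s 3) ≠ 0) :
    ∃ b c, S b c ≠ 0 ∧ s ∈ z2Orbit .x b c .x := by
  have hs : s = ![s 0, s 1, s 2, s 3] := by
    funext a; fin_cases a <;> rfl
  generalize s 0 = a at *
  generalize s 1 = b at *
  generalize s 2 = c at *
  generalize s 3 = d at *
  subst hs
  have key : (a = .x ∧ d = .x ∧ S b c ≠ 0) ∨ (b = .x ∧ d = .x ∧ S a c ≠ 0) ∨
      (a = .x ∧ c = .x ∧ S b d ≠ 0) ∨ (b = .x ∧ c = .x ∧ S a d ≠ 0) := by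
    by_contra hk
    push Not at hk
    obtain ⟨h1, h2, h3, h4⟩ := hk
    apply h
    unfold curvEntries
    rw [ite_eq_right_iff.2 fun h => h1 h.1 h.2, ite_eq_right_iff.2 fun h => h2 h.1 h.2,
      ite_eq_right_iff.2 fun h => h3 h.1 h.2, ite_eq_right_iff.2 fun h => h4 h.1 h.2]
    ring
  rcases key with ⟨rfl, rfl, hS⟩ | ⟨rfl, rfl, hS⟩ | ⟨rfl, rfl, hS⟩ | ⟨rfl, rfl, hS⟩ <;>
    exact ⟨_, _, hS, by simp [z2Orbit]⟩

/-- Interchanging the pairs and reversing both of them exchanges the middle indices, so the order in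
which u_i and v_{i+1} occur is immaterial. -/
theorem z2Orbit_swap {ι : Type} (a b c : ι) : z2Orbit a b c a = z2Orbit a c b a := by
  ext s
  simp only [z2Orbit, Set.mem_insert_iff, Set.mem_singleton_iff]
  tauto

theorem shiftForm_u_v_ne_zero {i j : Fin r} (h : shiftForm (.u i) (.v j) ≠ 0) :
    ∃ k : Fin (r - 1), i = lowIdx r k ∧ j = nextIdx r k := by
  have h1 : i.val + 1 = j.val := by
    by_contra hn; exact h (if_neg hn)
  exact ⟨⟨i.val, by omega⟩, rfl, Fin.ext h1.symm⟩

theorem hessForm_ne_zero {c : ℝ} {a b : Coord r} (h : hessForm hr c a b ≠ 0) :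
    (a = .u (lastIdx r hr) ∧ b = .u (lastIdx r hr)) ∨
    ∃ i : Fin (r - 1), (a = .u (lowIdx r i) ∧ b = .v (nextIdx r i)) ∨
      (b = .u (lowIdx r i) ∧ a = .v (nextIdx r i)) := by
  cases a with
  | x => simp at h
  | y => simp at h
  | u i =>
    cases b with
    | x => simp at h
    | y => simp at h
    | u j =>
      left
      by_contra hn
      apply h
      rw [not_and_or] at hn
      rcases hn with hn | hn <;> simp [hessForm, shiftForm, lastInd, hn]
    | v j =>
      obtain ⟨k, rfl, rfl⟩ := shiftForm_u_v_ne_zero (i := i) (j := j) (by simpa [hessForm] using h)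
      exact .inr ⟨k, .inl ⟨rfl, rfl⟩⟩
  | v i =>
    cases b with
    | x => simp at h
    | y => simp at h
    | v j => simp [hessForm, shiftForm] at h
    | u j =>
      rw [hessForm_comm] at h
      obtain ⟨k, rfl, rfl⟩ := shiftForm_u_v_ne_zero (i := j) (j := i) (by simpa [hessForm] using h)
      exact .inr ⟨k, .inr ⟨rfl, rfl⟩⟩

variable {ψ : ℝ → ℝ} (hψ : ContDiff ℝ ∞ ψ)
include hψ

theorem riemann_metric_last (P : Coord r → ℝ) :
    riemann (metric r hr ψ) P ![.x, .u (lastIdx r hr), .u (lastIdx r hr), .x] =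
      iteratedDeriv 2 ψ (P (.u (lastIdx r hr))) := by
  rw [riemann_metric hr hψ]
  simp [curvEntries, hessForm, shiftForm]

theorem riemann_metric_low (P : Coord r → ℝ) (i : Fin (r - 1)) :
    riemann (metric r hr ψ) P ![.x, .u (lowIdx r i), .v (nextIdx r i), .x] = 1 := by
  rw [riemann_metric hr hψ]
  simp [curvEntries, hessForm, shiftForm, lowIdx, nextIdx]

theorem mem_of_riemann_metric_ne_zero (P : Coord r → ℝ) (s : Fin 4 → Coord r)
    (h : riemann (metric r hr ψ) P s ≠ 0) :
    s ∈ z2Orbit .x (.u (lastIdx r hr)) (.u (lastIdx r hr)) .x ∨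
      ∃ i : Fin (r - 1), s ∈ z2Orbit .x (.u (lowIdx r i)) (.v (nextIdx r i)) .x := by
  rw [riemann_metric hr hψ] at h
  obtain ⟨b, c, hbc, hs⟩ := mem_z2Orbit_of_curvEntries_ne_zero h
  rcases hessForm_ne_zero hr hbc with ⟨rfl, rfl⟩ | ⟨i, ⟨rfl, rfl⟩ | ⟨rfl, rfl⟩⟩
  · exact .inl hs
  · exact .inr ⟨i, hs⟩
  · exact .inr ⟨i, z2Orbit_swap (.x : Coord r) _ _ ▸ hs⟩

theorem covDeriv_riemann_metric_last (P : Coord r → ℝ) :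
    covDeriv (metric r hr ψ) (riemann (metric r hr ψ)) P
        ![.x, .u (lastIdx r hr), .u (lastIdx r hr), .x, .u (lastIdx r hr)] =
      iteratedDeriv 3 ψ (P (.u (lastIdx r hr))) := by
  rw [covDeriv_riemann_metric hr hψ]
  simp [curvEntries, jacobiForm₁]

theorem mem_of_covDeriv_riemann_metric_ne_zero (P : Coord r → ℝ) (s : Fin 5 → Coord r)
    (h : covDeriv (metric r hr ψ) (riemann (metric r hr ψ)) P s ≠ 0) :
    s 4 = .u (lastIdx r hr) ∧ (fun a : Fin 4 => s a.castSucc) ∈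
      z2Orbit .x (.u (lastIdx r hr)) (.u (lastIdx r hr)) .x := by
  rw [covDeriv_riemann_metric hr hψ] at h
  refine ⟨by_contra fun hn => h (by simp [lastInd, hn]), ?_⟩
  obtain ⟨b, c, hbc, hs⟩ := mem_z2Orbit_of_curvEntries_ne_zero
    (s := fun a : Fin 4 => s a.castSucc) (right_ne_zero_of_mul h)
  rw [jacobiForm₁_eq] at hbc
  have hb : b = .u (lastIdx r hr) :=
    by_contra fun hn => hbc (by rw [lastInd, if_neg hn, zero_mul])
  have hc : c = .u (lastIdx r hr) :=
    by_contra fun hn => hbc (by rw [lastInd.eq_def hr c, if_neg hn, mul_zero])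
  rwa [hb, hc] at hs

end Components

/-! ### Multilinear forms given by components -/

section Tensors

variable {ι : Type} [Fintype ι]

theorem ofComponents_apply {n : ℕ} (T : (Fin n → ι) → ℝ) (v : Fin n → ι → ℝ) :
    ofComponents T v = ∑ s, T s * ∏ a, v a (s a) := by
  simp [ofComponents]

theorem ofComponents_single [DecidableEq ι] {n : ℕ} (T : (Fin n → ι) → ℝ) (s : Fin n → ι) :
    ofComponents T (fun a => Pi.single (s a) 1) = T s := by
  rw [ofComponents_apply, Finset.sum_eq_single s]
  · simp
  · intro t _ ht
    obtain ⟨a, ha⟩ := Function.ne_iff.1 ht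
    rw [Finset.prod_eq_zero (Finset.mem_univ a) (Pi.single_eq_of_ne ha _), mul_zero]
  · simp

theorem sum_fin_succ_fun {n : ℕ} (f : (Fin (n + 1) → ι) → ℝ) :
    ∑ s, f s = ∑ a, ∑ t : Fin n → ι, f (Fin.cons a t) := by
  rw [← (Fin.consEquiv fun _ : Fin (n + 1) => ι).sum_comp, Fintype.sum_prod_type]
  rfl

theorem sum_fin_four_fun (f : ι → ι → ι → ι → ℝ) :
    ∑ s : Fin 4 → ι, f (s 0) (s 1) (s 2) (s 3) = ∑ a, ∑ b, ∑ c, ∑ d, f a b c d := by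
  simp only [sum_fin_succ_fun, Finset.univ_unique, Finset.sum_singleton]
  rfl

/-- A tensor whose last slot splits off as a linear factor. -/
theorem ofComponents_mul_last {n : ℕ} (T : (Fin n → ι) → ℝ) (φ : ι → ℝ)
    (v : Fin (n + 1) → ι → ℝ) :
    ofComponents (fun s : Fin (n + 1) → ι => T (fun a => s a.castSucc) * φ (s (Fin.last n))) v =
      ofComponents T (fun a => v a.castSucc) * ∑ b, φ b * v (Fin.last n) b := by
  simp only [ofComponents_apply]
  rw [← (Fin.snocEquiv fun _ : Fin (n + 1) => ι).sum_comp, Fintype.sum_prod_type,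
    Finset.sum_comm, Finset.sum_mul]
  refine Finset.sum_congr rfl fun s _ => ?_
  rw [Finset.mul_sum]
  refine Finset.sum_congr rfl fun b _ => ?_
  simp only [Fin.snocEquiv, Equiv.coe_fn_mk, Fin.snoc_castSucc, Fin.snoc_last,
    Fin.prod_univ_castSucc]
  ring

end Tensors

/-! ### Curvature-like tensors as closed expressions -/

section ClosedForms

variable {r : ℕ}

/-- The bilinear form with components `S`. -/
def bilin (S : Coord r → Coord r → ℝ) (v w : Coord r → ℝ) : ℝ :=
  ∑ a, ∑ b, S a b * (v a * w b)

/-- The curvature-like tensor with the components `curvEntries S`. -/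
def curvForm (S : Coord r → Coord r → ℝ) (v₀ v₁ v₂ v₃ : Coord r → ℝ) : ℝ :=
  v₀ .x * v₃ .x * bilin S v₁ v₂ - v₁ .x * v₃ .x * bilin S v₀ v₂ -
    v₀ .x * v₂ .x * bilin S v₁ v₃ + v₁ .x * v₂ .x * bilin S v₀ v₃

theorem bilin_comm {S : Coord r → Coord r → ℝ} (hS : ∀ a b, S a b = S b a) (v w : Coord r → ℝ) :
    bilin S v w = bilin S w v := by
  unfold bilin
  rw [Finset.sum_comm]
  refine Finset.sum_congr rfl fun b _ => Finset.sum_congr rfl fun a _ => ?_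
  rw [hS]; ring

theorem ofComponents_curvEntries (S : Coord r → Coord r → ℝ) (v : Fin 4 → Coord r → ℝ) :
    ofComponents (fun s => curvEntries S (s 0) (s 1) (s 2) (s 3)) v =
      curvForm S (v 0) (v 1) (v 2) (v 3) := by
  rw [ofComponents_apply]
  simp only [Fin.prod_univ_four]
  rw [sum_fin_four_fun fun a b c d => curvEntries S a b c d * (v 0 a * v 1 b * v 2 c * v 3 d)]
  have h : ∀ a b c d, curvEntries S a b c d * (v 0 a * v 1 b * v 2 c * v 3 d) =
      xi a * (xi d * (v 0 a * v 3 d * (S b c * (v 1 b * v 2 c)))) -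
      xi b * (xi d * (v 1 b * v 3 d * (S a c * (v 0 a * v 2 c)))) -
      xi a * (xi c * (v 0 a * v 2 c * (S b d * (v 1 b * v 3 d)))) +
      xi b * (xi c * (v 1 b * v 2 c * (S a d * (v 0 a * v 3 d)))) := fun a b c d => by
    rw [curvEntries_eq]; ring
  simp only [h, Finset.sum_sub_distrib, Finset.sum_add_distrib, ← Finset.mul_sum, sum_xi_mul,
    curvForm, bilin]

theorem isAlgCurv_curvEntries {S : Coord r → Coord r → ℝ} (hS : ∀ a b, S a b = S b a) :
    IsAlgCurv (ofComponents fun s => curvEntries S (s 0) (s 1) (s 2) (s 3)) := by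
  refine ⟨fun x y z w => ?_, fun x y z w => ?_, fun x y z w => ?_⟩ <;>
    simp only [ofComponents_curvEntries, curvForm, Matrix.cons_val]
  · ring
  · rw [bilin_comm hS y z, bilin_comm hS x z, bilin_comm hS y w, bilin_comm hS x w]; ring
  · rw [bilin_comm hS x z, bilin_comm hS x y, bilin_comm hS y z]; ring

variable (hr : 2 ≤ r)

/-- The pairing of the `u_r`-coordinate with the coordinates of a vector. -/
theorem sum_lastInd_mul (v : Coord r → ℝ) :
    ∑ a, lastInd hr a * v a = v (.u (lastIdx r hr)) := by
  simp [lastInd]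

theorem bilin_jacobiForm₁ (v w : Coord r → ℝ) :
    bilin (jacobiForm₁ r hr) v w = v (.u (lastIdx r hr)) * w (.u (lastIdx r hr)) := by
  have h : ∀ a b, jacobiForm₁ r hr a b * (v a * w b) =
      lastInd hr a * v a * (lastInd hr b * w b) := fun a b => by rw [jacobiForm₁_eq]; ring
  simp only [bilin, h, ← Finset.mul_sum, ← Finset.sum_mul, sum_lastInd_mul]

theorem bilin_hessForm (c : ℝ) (v w : Coord r → ℝ) :
    bilin (hessForm hr c) v w = bilin shiftForm v w +
      c * (v (.u (lastIdx r hr)) * w (.u (lastIdx r hr))) := by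
  rw [← bilin_jacobiForm₁]
  simp only [bilin, hessForm, Finset.mul_sum, ← Finset.sum_add_distrib]
  refine Finset.sum_congr rfl fun a _ => Finset.sum_congr rfl fun b _ => ?_
  rw [jacobiForm₁_eq]; ring

/-- The tensor with the components of `∇R`. -/
theorem ofComponents_covDeriv_form (d : ℝ) (v : Fin 5 → Coord r → ℝ) :
    ofComponents (fun s : Fin 5 → Coord r => d * lastInd hr (s 4) *
      curvEntries (jacobiForm₁ r hr) (s 0) (s 1) (s 2) (s 3)) v =
    d * v 4 (.u (lastIdx r hr)) * curvForm (jacobiForm₁ r hr) (v 0) (v 1) (v 2) (v 3) := by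
  have h := ofComponents_mul_last (n := 4)
    (fun s => curvEntries (jacobiForm₁ r hr) (s 0) (s 1) (s 2) (s 3))
    (fun b => d * lastInd hr b) v
  rw [ofComponents_curvEntries] at h
  have h2 : ∑ b, d * lastInd hr b * v (Fin.last 4) b = d * v (Fin.last 4) (.u (lastIdx r hr)) := by
    rw [← sum_lastInd_mul hr (v (Fin.last 4)), Finset.mul_sum]
    exact Finset.sum_congr rfl fun b _ => by ring
  rw [h2, mul_comm] at h
  rw [show (fun s : Fin 5 → Coord r => d * lastInd hr (s 4) *
      curvEntries (jacobiForm₁ r hr) (s 0) (s 1) (s 2) (s 3)) = fun s => curvEntries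
      (jacobiForm₁ r hr) (s 0) (s 1) (s 2) (s 3) * (d * lastInd hr (s 4)) from
      funext fun s => mul_comm _ _]
  exact h

/-- The tensor is a multiple of (dx ∧ du_r) ⊗ (dx ∧ du_r) ⊗ du_r; its cyclic sum over the last three
slots contains dx ∧ du_r ∧ du_r = 0, which is the second Bianchi identity. -/
theorem isAlgCovDerivCurv_form (d : ℝ) :
    IsAlgCovDerivCurv (ofComponents fun s : Fin 5 → Coord r => d * lastInd hr (s 4) *
      curvEntries (jacobiForm₁ r hr) (s 0) (s 1) (s 2) (s 3)) := by
  refine ⟨fun x y z w v => ?_, fun x y z w v => ?_, fun x y z w v => ?_, fun x y z w v => ?_⟩ <;>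
    simp only [ofComponents_covDeriv_form, curvForm, bilin_jacobiForm₁, Matrix.cons_val] <;> ring

end ClosedForms

/-! ### Algebraic symmetries of the models -/

section Models

variable {r : ℕ} (hr : 2 ≤ r)

/-- The model form is a member of the family with zero potential, so facts about the metric apply to
it. -/
theorem modelForm_eq_metric : modelForm r = metric r hr (fun _ => 0) 0 := by
  ext a b
  rw [modelForm_eq, metric_eq]
  simp [potential]

theorem nondegenerate_toBilin'_metric (ψ : ℝ → ℝ) (p : Coord r → ℝ) :
    (Matrix.toBilin' (metric r hr ψ p)).Nondegenerate :=
  LinearMap.BilinForm.nondegenerate_toBilin'_of_det_ne_zero' _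
    (Matrix.isUnit_det_of_right_inverse (metric_mul_metricInv hr ψ p)).ne_zero

theorem modelA_eq : modelA r hr =
    ofComponents fun s => curvEntries (hessForm hr 1) (s 0) (s 1) (s 2) (s 3) := by
  rw [modelA, jacobiForm_eq]

theorem modelA₁_eq : modelA₁ r hr = ofComponents fun s : Fin 5 → Coord r => 1 * lastInd hr (s 4) *
    curvEntries (jacobiForm₁ r hr) (s 0) (s 1) (s 2) (s 3) := by
  rw [modelA₁]
  congr 1
  funext s
  rw [lastInd]
  split_ifs <;> ring

theorem isAlgebraic_modelU : (modelU r hr).IsAlgebraic where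
  symm x y := by
    change Matrix.toBilin' (modelForm r) x y = Matrix.toBilin' (modelForm r) y x
    rw [modelForm_eq_metric hr, toBilin'_metric_comm]
  nondegenerate := by
    change (Matrix.toBilin' (modelForm r)).Nondegenerate
    rw [modelForm_eq_metric hr]
    exact nondegenerate_toBilin'_metric hr _ _
  curv := by
    change IsAlgCurv (modelA r hr)
    rw [modelA_eq]
    exact isAlgCurv_curvEntries (hessForm_comm hr 1)
  covDerivCurv h := absurd h (by omega)

theorem isAlgebraic_modelU₁ : (modelU₁ r hr).IsAlgebraic where
  symm := (isAlgebraic_modelU hr).symm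
  nondegenerate := (isAlgebraic_modelU hr).nondegenerate
  curv := (isAlgebraic_modelU hr).curv
  covDerivCurv _ := by
    change IsAlgCovDerivCurv (modelA₁ r hr)
    rw [modelA₁_eq]
    exact isAlgCovDerivCurv_form hr 1

variable {ψ : ℝ → ℝ} (hψ : ContDiff ℝ ∞ ψ)
include hψ

theorem ofComponents_nablaR_zero (P : Coord r → ℝ) :
    ofComponents (nablaR (metric r hr ψ) 0 P) = ofComponents fun s => curvEntries
      (hessForm hr (iteratedDeriv 2 ψ (P (.u (lastIdx r hr))))) (s 0) (s 1) (s 2) (s 3) :=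
  congrArg ofComponents (funext fun s => riemann_metric hr hψ P s)

theorem ofComponents_nablaR_one (P : Coord r → ℝ) :
    ofComponents (nablaR (metric r hr ψ) 1 P) = ofComponents fun s : Fin 5 → Coord r =>
      iteratedDeriv 3 ψ (P (.u (lastIdx r hr))) * lastInd hr (s 4) *
        curvEntries (jacobiForm₁ r hr) (s 0) (s 1) (s 2) (s 3) :=
  congrArg ofComponents (funext fun s => covDeriv_riemann_metric hr hψ P s)

theorem isAlgebraic_tangentModel (P : Coord r → ℝ) :
    (tangentModel (metric r hr ψ) 1 P).IsAlgebraic where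
  symm x y := toBilin'_metric_comm hr ψ P x y
  nondegenerate := nondegenerate_toBilin'_metric hr ψ P
  curv := by
    change IsAlgCurv (ofComponents (nablaR (metric r hr ψ) 0 P))
    rw [ofComponents_nablaR_zero hr hψ]
    exact isAlgCurv_curvEntries (hessForm_comm hr _)
  covDerivCurv _ := by
    change IsAlgCovDerivCurv (ofComponents (nablaR (metric r hr ψ) 1 P))
    rw [ofComponents_nablaR_one hr hψ]
    exact isAlgCovDerivCurv_form hr _

end Models

/-! ### Normal form of g, R and ∇R -/

section Normalization

variable {r : ℕ} (hr : 2 ≤ r)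

/-- The linear change of frame that scales `u_i` by `m i`, `v_i` by `(m i)⁻¹`, and normalizes
the `(x, y)`-plane, where `g(∂_x, ∂_x) = -2 f`. -/
def frameChange (f : ℝ) (a : ℝ) (ha : a ≠ 0) (m : Fin r → ℝ) (hm : ∀ i, m i ≠ 0) :
    (Coord r → ℝ) ≃ₗ[ℝ] (Coord r → ℝ) where
  toFun p
    | .u i => m i * p (.u i)
    | .v i => (m i)⁻¹ * p (.v i)
    | .x => a⁻¹ * p .x
    | .y => a * (p .y - f * p .x)
  invFun p
    | .u i => (m i)⁻¹ * p (.u i)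
    | .v i => m i * p (.v i)
    | .x => a * p .x
    | .y => a⁻¹ * p .y + f * (a * p .x)
  map_add' p q := by funext c; cases c <;> simp <;> ring
  map_smul' t p := by funext c; cases c <;> simp <;> ring
  left_inv p := by funext c; cases c <;> simp [ha, hm]
  right_inv p := by funext c; cases c <;> simp [ha, hm]

variable (f a : ℝ) (ha : a ≠ 0) (m : Fin r → ℝ) (hm : ∀ i, m i ≠ 0)

theorem frameChange_x (p : Coord r → ℝ) : frameChange f a ha m hm p .x = a⁻¹ * p .x := rfl

theorem frameChange_u (p : Coord r → ℝ) (i : Fin r) :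
    frameChange f a ha m hm p (.u i) = m i * p (.u i) := rfl

theorem modelForm_frameChange (ψ : ℝ → ℝ) (P v w : Coord r → ℝ) :
    Matrix.toBilin' (modelForm r) (frameChange (potential hr ψ P) a ha m hm v)
      (frameChange (potential hr ψ P) a ha m hm w) = Matrix.toBilin' (metric r hr ψ P) v w := by
  rw [modelForm_eq_metric hr, toBilin'_metric, toBilin'_metric, Coord.sum_eq, Coord.sum_eq]
  have h0 : potential hr (fun _ => 0) 0 = 0 := by simp [potential]
  have h1 : ∀ i, m i * v (.u i) * ((m i)⁻¹ * w (.v i)) = v (.u i) * w (.v i) := fun i => by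
    have := hm i
    field_simp
  have h2 : ∀ i, (m i)⁻¹ * v (.v i) * (m i * w (.u i)) = v (.v i) * w (.u i) := fun i => by
    have := hm i
    field_simp
  simp only [h0, frameChange, LinearEquiv.coe_mk, LinearMap.coe_mk, AddHom.coe_mk, Coord.dual_u,
    Coord.dual_v, Coord.dual_x, Coord.dual_y, h1, h2]
  field_simp
  ring

/-- Every pair (u_i, v_{i+1}) is scaled by m_i / m_{i+1} = a². In the curvature this is compensated
by the factor a⁻² from the two x-slots. -/
theorem bilin_shiftForm_frameChange
    (hstep : ∀ i j : Fin r, i.val + 1 = j.val → m i = a ^ 2 * m j) (v w : Coord r → ℝ) :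
    bilin shiftForm (frameChange f a ha m hm v) (frameChange f a ha m hm w) =
      a ^ 2 * bilin shiftForm v w := by
  simp only [bilin, Finset.mul_sum]
  refine Finset.sum_congr rfl fun b _ => Finset.sum_congr rfl fun c _ => ?_
  by_cases hbc : shiftForm b c = 0
  · simp [hbc]
  · have key : ∀ i j : Fin r, shiftForm (.u i) (.v j) ≠ 0 → m i * (m j)⁻¹ = a ^ 2 := fun i j h => by
      have := hm j
      rw [hstep i j (by_contra fun hn => h (if_neg hn))]
      field_simp
    cases b with
    | u i =>
      cases c with
      | v j =>
        change shiftForm (.u i) (.v j) * (m i * v (.u i) * ((m j)⁻¹ * w (.v j))) = _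
        linear_combination shiftForm (.u i) (.v j) * v (.u i) * w (.v j) * key i j hbc
      | _ => exact absurd rfl hbc
    | v j =>
      cases c with
      | u i =>
        rw [shiftForm_comm] at hbc ⊢
        change shiftForm (.u i) (.v j) * ((m j)⁻¹ * v (.v j) * (m i * w (.u i))) = _
        linear_combination shiftForm (.u i) (.v j) * w (.u i) * v (.v j) * key i j hbc
      | _ => exact absurd rfl hbc
    | _ => exact absurd (by simp) hbc

/-- The frame change carries the curvature of the metric and its covariant derivative to those of
the models, for `ψ'' = c` and `ψ''' = d`. -/
theorem exists_frameChange (f : ℝ) {c d : ℝ} (hc : 0 < c) (hd : 0 < d) :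
    ∃ (a : ℝ) (ha : a ≠ 0) (m : Fin r → ℝ) (hm : ∀ i, m i ≠ 0),
      (∀ v₀ v₁ v₂ v₃, curvForm (hessForm hr 1) (frameChange f a ha m hm v₀)
        (frameChange f a ha m hm v₁) (frameChange f a ha m hm v₂) (frameChange f a ha m hm v₃) =
        curvForm (hessForm hr c) v₀ v₁ v₂ v₃) ∧
      (∀ v₀ v₁ v₂ v₃ v₄, 1 * frameChange f a ha m hm v₄ (.u (lastIdx r hr)) *
        curvForm (jacobiForm₁ r hr) (frameChange f a ha m hm v₀)
        (frameChange f a ha m hm v₁) (frameChange f a ha m hm v₂) (frameChange f a ha m hm v₃) =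
        d * v₄ (.u (lastIdx r hr)) * curvForm (jacobiForm₁ r hr) v₀ v₁ v₂ v₃) := by
  have hsq : Real.sqrt c ^ 2 = c := Real.sq_sqrt hc.le
  have hs0 : Real.sqrt c ≠ 0 := (Real.sqrt_pos.2 hc).ne'
  -- Matching the entries at u_r requires a⁻² m_r² = c in R and a⁻² m_r³ = d in ∇R. Hence m_r = d /
  -- c and a² = d² / c³.
  have ha : d / c / Real.sqrt c ≠ 0 := by positivity
  set a := d / c / Real.sqrt c with ha_def
  have ha2 : a ^ 2 = d ^ 2 / c ^ 3 := by
    rw [ha_def, div_pow, hsq]; field_simp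
  -- The solution of m_i = a² m_{i+1} that ends with m_r = d / c.
  let m : Fin r → ℝ := fun i => d / c * (a ^ 2) ^ (r - 1 - i.val)
  have hm : ∀ i, m i ≠ 0 := fun i => by
    have : d / c ≠ 0 := by positivity
    exact mul_ne_zero this (pow_ne_zero _ (pow_ne_zero _ ha))
  have hlast : m (lastIdx r hr) = d / c := by simp [m, lastIdx]
  have hstep : ∀ i j : Fin r, i.val + 1 = j.val → m i = a ^ 2 * m j := fun i j h => by
    have : r - 1 - i.val = r - 1 - j.val + 1 := by omega
    simp only [m, this, pow_succ]; ring
  refine ⟨a, ha, m, hm, fun v₀ v₁ v₂ v₃ => ?_, fun v₀ v₁ v₂ v₃ v₄ => ?_⟩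
  · simp only [curvForm, bilin_hessForm, bilin_shiftForm_frameChange f a ha m hm hstep,
      frameChange_x, frameChange_u, hlast]
    have e1 : a⁻¹ * a⁻¹ * a ^ 2 = 1 := by field_simp
    have e2 : a⁻¹ * a⁻¹ * (d / c * (d / c)) = c := by
      rw [← mul_inv, ← pow_two, ha2]; field_simp
    have key : ∀ p q s t B : ℝ, a⁻¹ * p * (a⁻¹ * q) * (a ^ 2 * B + 1 * (d / c * s * (d / c * t))) =
        p * q * (B + c * (s * t)) := fun p q s t B => by
      linear_combination p * q * B * e1 + p * q * s * t * e2
    simp only [key]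
  · simp only [curvForm, bilin_jacobiForm₁, frameChange_x, frameChange_u, hlast]
    have e2 : a⁻¹ * a⁻¹ * (d / c * (d / c)) = c := by
      rw [← mul_inv, ← pow_two, ha2]; field_simp
    have key : ∀ p q s t : ℝ, a⁻¹ * p * (a⁻¹ * q) * (d / c * s * (d / c * t)) =
        c * (p * q * (s * t)) := fun p q s t => by
      linear_combination p * q * s * t * e2
    simp only [key]
    field_simp

variable {ψ : ℝ → ℝ} (hψ : ContDiff ℝ ∞ ψ) (hψ₂ : ∀ t, 0 < iteratedDeriv 2 ψ t)
include hψ hψ₂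

theorem isModelFor_modelU₁ (hψ₃ : ∀ t, 0 < iteratedDeriv 3 ψ t) :
    (modelU₁ r hr).IsModelFor (metric r hr ψ) := by
  refine ⟨isAlgebraic_modelU₁ hr, fun P => ?_⟩
  obtain ⟨a, ha, m, hm, h1, h2⟩ := exists_frameChange hr (potential hr ψ P)
    (hψ₂ (P (.u (lastIdx r hr)))) (hψ₃ (P (.u (lastIdx r hr))))
  refine ⟨frameChange (potential hr ψ P) a ha m hm,
    fun x y => modelForm_frameChange hr a ha m hm ψ P x y, fun j v => ?_⟩
  match j, v with
  | ⟨0, _⟩, v =>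
    change modelA r hr _ = ofComponents (nablaR (metric r hr ψ) 0 P) v
    rw [modelA_eq, ofComponents_nablaR_zero hr hψ, ofComponents_curvEntries,
      ofComponents_curvEntries]
    exact h1 _ _ _ _
  | ⟨1, _⟩, v =>
    change modelA₁ r hr _ = ofComponents (nablaR (metric r hr ψ) 1 P) v
    rw [modelA₁_eq, ofComponents_nablaR_one hr hψ, ofComponents_covDeriv_form,
      ofComponents_covDeriv_form]
    exact h2 _ _ _ _ _

theorem isModelFor_modelU : (modelU r hr).IsModelFor (metric r hr ψ) := by
  refine ⟨isAlgebraic_modelU hr, fun P => ?_⟩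
  -- Only R has to be matched, so the second parameter is free and is set to 1.
  obtain ⟨a, ha, m, hm, h1, -⟩ := exists_frameChange hr (potential hr ψ P)
    (hψ₂ (P (.u (lastIdx r hr)))) one_pos
  refine ⟨frameChange (potential hr ψ P) a ha m hm,
    fun x y => modelForm_frameChange hr a ha m hm ψ P x y, fun j v => ?_⟩
  match j, v with
  | ⟨0, _⟩, v =>
    change modelA r hr _ = ofComponents (nablaR (metric r hr ψ) 0 P) v
    rw [modelA_eq, ofComponents_nablaR_zero hr hψ, ofComponents_curvEntries,
      ofComponents_curvEntries]
    exact h1 _ _ _ _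

end Normalization

/-! ### The obstruction to 2-curvature homogeneity -/

section TwoModels

variable {r : ℕ} (hr : 2 ≤ r) {ψ : ℝ → ℝ} (hψ : ContDiff ℝ ∞ ψ)
  (hψ₃ : ∀ t, 0 < iteratedDeriv 3 ψ t)
include hψ hψ₃

/-- In a `2`-model the condition that `A²(·, ·, ·, ·; ·, Z) = 0` whenever `A¹(·, ·, ·, ·; Z) = 0`
holds at the points with `u_{r-1} = 0` and fails at all others. -/
theorem not_isCurvatureHomogeneous_two : ¬ IsCurvatureHomogeneous 2 (metric r hr ψ) := by
  rintro ⟨V, _, _, U, -, hU⟩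
  have hvanish : ∀ Z : V, (∀ v : Fin 5 → V, v 4 = Z → U.tensor ⟨1, by omega⟩ v = 0) →
      ∀ v : Fin 6 → V, v 5 = Z → U.tensor ⟨2, by omega⟩ v = 0 := by
    -- At the origin u_{r-1} = 0, so the last slots of both ∇R and ∇²R factor through du_r; since
    -- ψ''' ≠ 0, a vector that annihilates ∇R has no u_r-component.
    obtain ⟨Φ, -, hΦ⟩ := hU 0
    intro Z hZ v hv
    have hlast : Φ.symm Z (.u (lastIdx r hr)) = 0 := by
      let w : Fin 5 → Coord r → ℝ := ![Pi.single .x 1, Pi.single (.u (lastIdx r hr)) 1,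
        Pi.single (.u (lastIdx r hr)) 1, Pi.single .x 1, Φ.symm Z]
      have h := hΦ ⟨1, by omega⟩ w
      rw [hZ _ (by simp [w])] at h
      change 0 = ofComponents (nablaR (metric r hr ψ) 1 0) w at h
      rw [ofComponents_nablaR_one hr hψ, ofComponents_covDeriv_form] at h
      simpa [w, curvForm, bilin_jacobiForm₁, (hψ₃ 0).ne'] using h
    have h := hΦ ⟨2, by omega⟩ (fun a => Φ.symm (v a))
    simp only [LinearEquiv.apply_symm_apply] at h
    refine h.trans ?_
    have hT : nablaR (metric r hr ψ) 2 0 = fun s : Fin 6 → Coord r =>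
        (iteratedDeriv 4 ψ 0 * lastInd hr (s 4) *
          curvEntries (jacobiForm₁ r hr) (s 0) (s 1) (s 2) (s 3)) * lastInd hr (s 5) :=
      funext fun s => by
        refine (covDeriv₂_riemann_metric hr hψ 0 s).trans ?_
        simp only [Pi.zero_apply]; ring
    change ofComponents (nablaR (metric r hr ψ) 2 0) _ = 0
    rw [hT]
    refine (ofComponents_mul_last (n := 5) (fun s => iteratedDeriv 4 ψ 0 * lastInd hr (s 4) *
      curvEntries (jacobiForm₁ r hr) (s 0) (s 1) (s 2) (s 3)) (lastInd hr) _).trans ?_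
    rw [sum_lastInd_mul]
    change _ * Φ.symm (v 5) _ = 0
    rw [hv, hlast, mul_zero]
  -- At a point with u_{r-1} = 1 the vector ∂_x annihilates the last slot of ∇R, whereas ∇²R(∂_x,
  -- ∂_{u_r}, ∂_{u_r}, ∂_x; ∂_x, ∂_x) = -ψ''' ≠ 0.
  obtain ⟨Φ, -, hΦ⟩ := hU (Pi.single (.u ⟨r - 2, by omega⟩) 1)
  have h1 := hvanish (Φ (Pi.single .x 1)) (fun v hv => by
    have h := hΦ ⟨1, by omega⟩ (fun a => Φ.symm (v a))
    simp only [LinearEquiv.apply_symm_apply] at h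
    refine h.trans ?_
    change ofComponents (nablaR (metric r hr ψ) 1 _) _ = 0
    rw [ofComponents_nablaR_one hr hψ, ofComponents_covDeriv_form, hv]
    simp)
  let s : Fin 6 → Coord r := ![.x, .u (lastIdx r hr), .u (lastIdx r hr), .x, .x, .x]
  have h2 := hΦ ⟨2, by omega⟩ (fun a => Pi.single (s a) 1)
  rw [h1 _ rfl] at h2
  change 0 = ofComponents (nablaR (metric r hr ψ) 2 _) (fun a : Fin 6 => Pi.single (s a) 1) at h2
  rw [ofComponents_single] at h2
  have h3 := h2.trans (covDeriv₂_riemann_metric hr hψ _ s)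
  simp [s, curvEntries, jacobiForm₁, (hψ₃ _).ne'] at h3

end TwoModels

/-! ### Irreducibility of the 0-models -/

section Irreducibility

variable {r : ℕ} (hr : 2 ≤ r)

theorem bilin_single (S : Coord r → Coord r → ℝ) (t : Coord r → ℝ) (b : Coord r) :
    bilin S t (Pi.single b 1) = ∑ a, S a b * t a := by
  unfold bilin
  refine Finset.sum_congr rfl fun a _ => ?_
  rw [Finset.sum_eq_single b]
  · simp
  · intro c _ hc; simp [hc]
  · simp

/-- A vector without `x`-component in the kernel of the Hessian form has no component along
`u_1, …, u_r` and `v_2, …, v_r`. -/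
theorem eq_zero_of_bilin_hessForm_eq_zero {c : ℝ} (hc : c ≠ 0) {t : Coord r → ℝ}
    (h : ∀ z : Coord r → ℝ, z .x = 0 → bilin (hessForm hr c) t z = 0) :
    (∀ i, t (.u i) = 0) ∧ ∀ i : Fin r, 1 ≤ i.val → t (.v i) = 0 := by
  -- Test vectors isolate one component at a time: v_{i+1} detects u_i, then u_r detects u_r because
  -- c ≠ 0, and finally u_{i-1} detects v_i.
  have hu : ∀ i : Fin r, i.val + 1 < r → t (.u i) = 0 := fun i hi => by
    have h1 := h (Pi.single (.v ⟨i.val + 1, hi⟩) 1) (by simp)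
    rw [bilin_single, Finset.sum_eq_single (.u i)] at h1
    · simpa [hessForm, shiftForm] using h1
    · intro a _ ha
      cases a with
      | u j =>
        have : ¬ j.val = i.val := fun hn => ha (by rw [Fin.ext hn])
        simp [hessForm, shiftForm, this]
      | _ => simp [hessForm, shiftForm]
    · simp
  have hlast : t (.u (lastIdx r hr)) = 0 := by
    have h1 := h (Pi.single (.u (lastIdx r hr)) 1) (by simp)
    rw [bilin_single, Finset.sum_eq_single (.u (lastIdx r hr))] at h1
    · simpa [hessForm, shiftForm, hc] using h1
    · intro a _ ha
      cases a with
      | u j => simp [hessForm, shiftForm, lastInd, ha]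
      | v j =>
        have : ¬ (lastIdx r hr).val + 1 = j.val := by simp only [lastIdx]; omega
        simp [hessForm, shiftForm, this]
      | _ => simp
    · simp
  have hu' : ∀ i, t (.u i) = 0 := fun i => by
    by_cases hi : i.val + 1 < r
    · exact hu i hi
    · have : i = lastIdx r hr := Fin.ext (by simp only [lastIdx]; omega)
      rw [this, hlast]
  refine ⟨hu', fun i hi => ?_⟩
  have h1 := h (Pi.single (.u ⟨i.val - 1, by omega⟩) 1) (by simp)
  rw [bilin_single, Finset.sum_eq_single (.v i)] at h1
  · have : i.val - 1 + 1 = i.val := by omega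
    simpa [hessForm, shiftForm, this] using h1
  · intro a _ ha
    cases a with
    | u j => rw [hu', mul_zero]
    | v j =>
      have : ¬ i.val - 1 + 1 = j.val := fun hn => ha (by rw [Fin.ext (show j.val = i.val by omega)])
      simp [hessForm, shiftForm, this]
    | _ => simp
  · simp

theorem bilin_sub_smul_left (S : Coord r → Coord r → ℝ) (v w z : Coord r → ℝ) (a : ℝ) :
    bilin S (v - a • w) z = bilin S v z - a * bilin S w z := by
  simp only [bilin, Finset.mul_sum, ← Finset.sum_sub_distrib]
  refine Finset.sum_congr rfl fun a _ => Finset.sum_congr rfl fun b _ => ?_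
  simp only [Pi.sub_apply, Pi.smul_apply, smul_eq_mul]; ring

/-- If `e` and `w` lie in different summands of a splitting of the curvature tensor and
`e` has `x`-component `1`, then `w - ξ(w) e` lies in the span of `v_1` and `y`. -/
theorem sub_smul_of_curvForm_eq_zero {c : ℝ} (hc : c ≠ 0) {e w : Coord r → ℝ} (he : e .x = 1)
    (h : ∀ z, curvForm (hessForm hr c) e w z e = 0) :
    (∀ i, w (.u i) = w .x * e (.u i)) ∧
      ∀ i : Fin r, 1 ≤ i.val → w (.v i) = w .x * e (.v i) := by
  obtain ⟨h1, h2⟩ := eq_zero_of_bilin_hessForm_eq_zero hr hc (t := w - w .x • e) fun z hz => by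
    have := h z
    simp only [curvForm, he, hz] at this
    rw [bilin_sub_smul_left]
    linarith
  refine ⟨fun i => ?_, fun i hi => ?_⟩
  · have := h1 i
    simp only [Pi.sub_apply, Pi.smul_apply, smul_eq_mul] at this
    linarith
  · have := h2 i hi
    simp only [Pi.sub_apply, Pi.smul_apply, smul_eq_mul] at this
    linarith

/-- The other summand is forced into the span of v_1 and y, which is totally isotropic; being
orthogonal to `W₁` as well, it lies in the radical of a non-degenerate form. -/
theorem eq_bot_of_curvForm_splits_aux {c : ℝ} (hc : c ≠ 0) (ψ : ℝ → ℝ) (P : Coord r → ℝ)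
    {W₁ W₂ : Submodule ℝ (Coord r → ℝ)} (hW : IsCompl W₁ W₂)
    (horth : ∀ x ∈ W₁, ∀ y ∈ W₂, Matrix.toBilin' (metric r hr ψ P) x y = 0)
    (h₁ : ∀ v ∈ W₁, ∀ w ∈ W₂, ∀ z, curvForm (hessForm hr c) v w z v = 0)
    (h₂ : ∀ w ∈ W₂, ∀ v ∈ W₁, ∀ z, curvForm (hessForm hr c) w v z w = 0)
    {e : Coord r → ℝ} (he : e ∈ W₁) (hex : e .x = 1) : W₂ = ⊥ := by
  have hsum : ∀ q : Coord r → ℝ, ∃ a ∈ W₁, ∃ b ∈ W₂, a + b = q := fun q =>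
    Submodule.mem_sup.1 (by rw [hW.sup_eq_top]; trivial)
  have hW₂ : ∀ w ∈ W₂, w .x = 0 := by
    intro w hw
    -- With x-components available in both summands, all vectors would satisfy q(u_1) = q(x) e(u_1),
    -- which the basis vector of u_1 violates.
    by_contra hwx
    have h3 : ∀ v ∈ W₁, ∀ i, v (.u i) = v .x * ((w .x)⁻¹ • w) (.u i) := fun v hv =>
      (sub_smul_of_curvForm_eq_zero hr hc (by simp [hwx])
        (h₂ _ (W₂.smul_mem _ hw) _ hv)).1
    have hew := h3 e he ⟨0, by omega⟩
    obtain ⟨a, ha, b, hb, hab⟩ := hsum (Pi.single (.u ⟨0, by omega⟩) 1)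
    have ha' := h3 a ha ⟨0, by omega⟩
    have hb' := (sub_smul_of_curvForm_eq_zero hr hc hex (h₁ _ he _ hb)).1 ⟨0, by omega⟩
    have hx := congrFun hab .x
    have hu := congrFun hab (.u ⟨0, by omega⟩)
    rw [hex, one_mul] at hew
    rw [← hew] at ha'
    simp only [Pi.add_apply, Pi.single_eq_same] at hu
    simp only [Pi.add_apply, ne_eq, reduceCtorEq, not_false_eq_true, Pi.single_eq_of_ne] at hx
    rw [ha', hb', ← add_mul, hx, zero_mul] at hu
    exact zero_ne_one hu
  have hK : ∀ w ∈ W₂, w .x = 0 ∧ (∀ i, w (.u i) = 0) ∧ ∀ i : Fin r, 1 ≤ i.val → w (.v i) = 0 := by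
    intro w hw
    obtain ⟨h1, h2⟩ := sub_smul_of_curvForm_eq_zero hr hc hex (h₁ _ he _ hw)
    simp only [hW₂ w hw, zero_mul] at h1 h2
    exact ⟨hW₂ w hw, h1, h2⟩
  rw [Submodule.eq_bot_iff]
  intro w hw
  have hB : ∀ q, Matrix.toBilin' (metric r hr ψ P) w q = 0 := by
    intro q
    obtain ⟨a, ha, b, hb, rfl⟩ := hsum q
    rw [map_add, toBilin'_metric_comm, horth a ha w hw, zero_add, toBilin'_metric, Coord.sum_eq]
    simp [(hK w hw).1, (hK w hw).2.1, (hK b hb).1, (hK b hb).2.1]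
  funext a
  have := hB (Pi.single a.dual 1)
  rw [toBilin'_metric, (hK w hw).1, zero_mul, mul_zero, sub_zero,
    Finset.sum_eq_single a] at this
  · simpa using this
  · intro b _ hb
    rw [Pi.single_eq_of_ne, mul_zero]
    intro h
    apply hb
    rw [← b.dual_dual, h, a.dual_dual]
  · simp

/-- The metric and the curvature tensor have no common non-trivial splitting. -/
theorem eq_bot_of_curvForm_splits {c : ℝ} (hc : c ≠ 0) (ψ : ℝ → ℝ) (P : Coord r → ℝ)
    {W₁ W₂ : Submodule ℝ (Coord r → ℝ)} (hW : IsCompl W₁ W₂)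
    (horth : ∀ x ∈ W₁, ∀ y ∈ W₂, Matrix.toBilin' (metric r hr ψ P) x y = 0)
    (h₁ : ∀ v ∈ W₁, ∀ w ∈ W₂, ∀ z, curvForm (hessForm hr c) v w z v = 0)
    (h₂ : ∀ w ∈ W₂, ∀ v ∈ W₁, ∀ z, curvForm (hessForm hr c) w v z w = 0) :
    W₁ = ⊥ ∨ W₂ = ⊥ := by
  obtain ⟨a, ha, b, hb, hab⟩ : ∃ a ∈ W₁, ∃ b ∈ W₂, a + b = Pi.single .x 1 :=
    Submodule.mem_sup.1 (by rw [hW.sup_eq_top]; trivial)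
  by_cases hax : a .x = 0
  · have hbx : b .x = 1 := by
      have := congrFun hab .x
      simpa [hax] using this
    refine .inl (eq_bot_of_curvForm_splits_aux hr hc ψ P hW.symm (fun x hx y hy => ?_) h₂ h₁ hb hbx)
    rw [toBilin'_metric_comm]
    exact horth y hy x hx
  · exact .inr (eq_bot_of_curvForm_splits_aux hr hc ψ P hW horth h₁ h₂
      (W₁.smul_mem (a .x)⁻¹ ha) (by simp [hax]))

/-- A `0`-model whose form is that of the metric and whose curvature tensor is that of a Hessian
form with `c ≠ 0` is irreducible. -/
theorem isIrreducible_of_tensor_eq {c : ℝ} (hc : c ≠ 0) (ψ : ℝ → ℝ) (P : Coord r → ℝ)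
    {U : ModelSpace 0 (Coord r → ℝ)} (hform : U.form = Matrix.toBilin' (metric r hr ψ P))
    (hA : U.tensor 0 = ofComponents fun s : Fin 4 → Coord r =>
      curvEntries (hessForm hr c) (s 0) (s 1) (s 2) (s 3)) : U.IsIrreducible := by
  have : Nonempty (Coord r) := ⟨.x⟩
  refine ⟨inferInstance, fun W₁ W₂ hW horth hsplit => ?_⟩
  have hsplit' : ∀ v w : Fin 4 → Coord r → ℝ, (∀ a, v a ∈ W₁) → (∀ a, w a ∈ W₂) →
      curvForm (hessForm hr c) (v 0 + w 0) (v 1 + w 1) (v 2 + w 2) (v 3 + w 3) =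
      curvForm (hessForm hr c) (v 0) (v 1) (v 2) (v 3) +
      curvForm (hessForm hr c) (w 0) (w 1) (w 2) (w 3) := fun v w hv hw => by
    have h := hsplit 0 v w hv hw
    rw [hA] at h
    exact (ofComponents_curvEntries _ _).symm.trans (h.trans
      (congrArg₂ (· + ·) (ofComponents_curvEntries _ _) (ofComponents_curvEntries _ _)))
  have hsum : ∀ q : Coord r → ℝ, ∃ a ∈ W₁, ∃ b ∈ W₂, a + b = q := fun q =>
    Submodule.mem_sup.1 (by rw [hW.sup_eq_top]; trivial)
  have h0 : ∀ S : Coord r → Coord r → ℝ, ∀ v, bilin S v 0 = 0 ∧ bilin S 0 v = 0 := fun S v => by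
    simp [bilin]
  refine eq_bot_of_curvForm_splits hr hc ψ P hW
    (fun x hx y hy => hform ▸ (horth x hx y hy).1) (fun v hv w hw z => ?_)
    (fun w hw v hv z => ?_)
  · obtain ⟨a, ha, b, hb, rfl⟩ := hsum z
    -- The slotwise sum of the tuples is (v, w, z, v), while each tuple alone contains zeros that
    -- make the curvature vanish.
    have h := hsplit' ![v, 0, a, v] ![0, w, b, 0]
      (fun i => by fin_cases i <;> simp [hv, ha]) (fun i => by fin_cases i <;> simp [hw, hb])
    simpa [curvForm, h0] using h
  · obtain ⟨a, ha, b, hb, rfl⟩ := hsum z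
    have h := hsplit' ![0, v, a, 0] ![w, 0, b, w]
      (fun i => by fin_cases i <;> simp [hv, ha]) (fun i => by fin_cases i <;> simp [hw, hb])
    simpa [curvForm, h0] using h

theorem isIrreducible_modelU : (modelU r hr).IsIrreducible :=
  isIrreducible_of_tensor_eq hr one_ne_zero (fun _ => 0) 0
    (congrArg Matrix.toBilin' (modelForm_eq_metric hr)) (modelA_eq hr)

variable {ψ : ℝ → ℝ} (hψ : ContDiff ℝ ∞ ψ) (hψ₂ : ∀ t, 0 < iteratedDeriv 2 ψ t)
include hψ hψ₂

theorem isIrreducible_tangentModel (P : Coord r → ℝ) :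
    (tangentModel (metric r hr ψ) 0 P).IsIrreducible :=
  isIrreducible_of_tensor_eq hr (hψ₂ _).ne' ψ P rfl (ofComponents_nablaR_zero hr hψ P)

end Irreducibility

/-! ### Parallel endomorphisms commute with curvature -/

section ParallelProjections

variable {ι : Type} [Fintype ι] [DecidableEq ι]

theorem pd_comm {f : (ι → ℝ) → ℝ} (hf : ContDiff ℝ ∞ f) (i j : ι) (p : ι → ℝ) :
    pd (fun q => pd f i q) j p = pd (fun q => pd f j q) i p := by
  have hd : DifferentiableAt ℝ (fderiv ℝ f) p :=
    ((hf.fderiv_right (m := 1) (by norm_cast)).differentiable (by simp)) p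
  have h : ∀ a b : ι, pd (fun q => pd f a q) b p =
      fderiv ℝ (fderiv ℝ f) p (Pi.single b 1) (Pi.single a 1) := by
    intro a b
    simp only [pd]
    rw [fderiv_clm_apply hd (differentiableAt_const _)]
    simp
  rw [h, h]
  exact ((contDiff_infty.1 hf 2).contDiffAt.isSymmSndFDerivAt (by simp)).eq _ _

/-- A parallel field of endomorphisms commutes with the curvature operators. -/
theorem curvatureOp_comm_of_parallel {g : (ι → ℝ) → Matrix ι ι ℝ}
    {E : (ι → ℝ) → Matrix ι ι ℝ} (hE : ∀ k i, ContDiff ℝ ∞ (fun p => E p k i))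
    (hΓ : ∀ k i j, ContDiff ℝ ∞ (fun p => christoffel g p k i j))
    (hpar : ∀ p i j k, pd (fun q => E q k i) j p + ∑ m, christoffel g p k j m * E p m i -
      ∑ m, christoffel g p m j i * E p k m = 0) (p : ι → ℝ) (i j k l : ι) :
    ∑ m, curvatureOp g p i j m l * E p m k = ∑ m, curvatureOp g p i j k m * E p l m := by
  have hE' := fun k i => (hE k i).differentiable (by simp)
  have hΓ' := fun k i j => (hΓ k i j).differentiable (by simp)
  let Γ : (ι → ℝ) → ι → Matrix ι ι ℝ := fun q j => Matrix.of fun k m => christoffel g q k j m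
  let D : ι → ι → Matrix ι ι ℝ := fun i j =>
    Matrix.of fun k m => pd (fun q => christoffel g q k j m) i p
  -- Parallelism reads ∂_jE = [E, Γ_j]; the symmetry of the second derivatives of E is then
  -- equivalent to [R_ij, E] = 0.
  have hpar' : ∀ q j k i, pd (fun q => E q k i) j q = (E q * Γ q j - Γ q j * E q) k i := by
    intro q j k i
    have := hpar q i j k
    simp only [Matrix.sub_apply, Matrix.mul_apply, Γ, Matrix.of_apply, mul_comm (E q k _)]
    linarith
  have hpd2 : ∀ a b k i, pd (fun q => pd (fun q => E q k i) b q) a p =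
      ((E p * Γ p a - Γ p a * E p) * Γ p b + E p * D a b -
        D a b * E p - Γ p b * (E p * Γ p a - Γ p a * E p)) k i := by
    intro a b k i
    simp only [hpar']
    have hC : ∀ k i, pd (fun q => E q k i) a p = (E p * Γ p a - Γ p a * E p) k i := hpar' p a
    have hD : ∀ k i, pd (fun q => christoffel g q k b i) a p = D a b k i := fun _ _ => rfl
    -- The commutator is kept opaque so that only the outer matrix products are expanded.
    generalize E p * Γ p a - Γ p a * E p = C at hC ⊢
    generalize D a b = D' at hD ⊢
    simp only [Matrix.add_apply, Matrix.sub_apply, Matrix.mul_apply, Γ, Matrix.of_apply]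
    rw [pd_sub (by fun_prop) (by fun_prop), pd_sum (fun _ _ => by fun_prop),
      pd_sum (fun _ _ => by fun_prop)]
    have h1 : ∀ m, pd (fun q => E q k m * christoffel g q m b i) a p =
        C k m * christoffel g p m b i + E p k m * D' m i := fun m => by
      rw [pd_mul (by fun_prop) (by fun_prop), hC, hD]; ring
    have h2 : ∀ m, pd (fun q => christoffel g q k b m * E q m i) a p =
        D' k m * E p m i + christoffel g p k b m * C m i := fun m => by
      rw [pd_mul (by fun_prop) (by fun_prop), hC, hD]; ring
    simp only [h1, h2, Finset.sum_add_distrib]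
    ring
  have hsymm : ∀ k i', ((E p * Γ p i - Γ p i * E p) * Γ p j + E p * D i j -
        D i j * E p - Γ p j * (E p * Γ p i - Γ p i * E p)) k i' =
      ((E p * Γ p j - Γ p j * E p) * Γ p i + E p * D j i -
        D j i * E p - Γ p i * (E p * Γ p j - Γ p j * E p)) k i' := fun k i' => by
    rw [← hpd2, ← hpd2]
    exact pd_comm (hE k i') j i p
  have hsymm' := Matrix.ext hsymm
  let R : Matrix ι ι ℝ := D i j - D j i + (Γ p i * Γ p j - Γ p j * Γ p i)
  have hR : ∀ k l, curvatureOp g p i j k l = R l k := by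
    intro k l
    simp only [R, Matrix.add_apply, Matrix.sub_apply, Matrix.mul_apply, ← Finset.sum_sub_distrib,
      curvatureOp]
    congr 1
    refine Finset.sum_congr rfl fun m _ => ?_
    simp only [Γ, Matrix.of_apply]
    ring
  have hcomm : R * E p = E p * R := by
    have h0 : R * E p - E p * R =
        ((E p * Γ p j - Γ p j * E p) * Γ p i + E p * D j i -
        D j i * E p - Γ p i * (E p * Γ p j - Γ p j * E p)) -
        ((E p * Γ p i - Γ p i * E p) * Γ p j + E p * D i j -
        D i j * E p - Γ p j * (E p * Γ p i - Γ p i * E p)) := by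
      simp only [R]; noncomm_ring
    rw [hsymm', sub_self] at h0
    exact sub_eq_zero.1 h0
  have := congrFun (congrFun hcomm l) k
  simp only [Matrix.mul_apply] at this
  simp only [hR, this, mul_comm (E p l _)]

end ParallelProjections

/-! ### Symmetries of the curvature form -/

section CurvFormSymmetries

variable {r : ℕ}

theorem curvForm_swap {S : Coord r → Coord r → ℝ} (a b z w : Coord r → ℝ) :
    curvForm S a b z w = -curvForm S a b w z := by
  simp only [curvForm]; ring

theorem curvForm_pair_symm {S : Coord r → Coord r → ℝ} (hS : ∀ a b, S a b = S b a)
    (a b z w : Coord r → ℝ) : curvForm S a b z w = curvForm S z w a b := by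
  simp only [curvForm]
  rw [bilin_comm hS z b, bilin_comm hS z a, bilin_comm hS w b, bilin_comm hS w a]; ring

end CurvFormSymmetries

/-! ### Absence of parallel splittings -/

section NoSplitting

variable {r : ℕ} (hr : 2 ≤ r) {ψ : ℝ → ℝ} (hψ : ContDiff ℝ ∞ ψ)
include hψ

/-- The curvature form is obtained from the curvature operators. -/
theorem curvForm_eq_sum (P a b z w : Coord r → ℝ) :
    curvForm (hessForm hr (iteratedDeriv 2 ψ (P (.u (lastIdx r hr))))) a b z w =
      ∑ i, ∑ j, a i * b j * Matrix.toBilin' (metric r hr ψ P)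
        (Matrix.mulVec (Matrix.of fun l k => curvatureOp (metric r hr ψ) P i j k l) z) w := by
  have h := ofComponents_curvEntries
    (hessForm hr (iteratedDeriv 2 ψ (P (.u (lastIdx r hr))))) ![a, b, z, w]
  rw [ofComponents_apply] at h
  simp only [← riemann_metric hr hψ, Fin.prod_univ_four] at h
  have h2 : ∀ s : Fin 4 → Coord r, riemann (metric r hr ψ) P s =
      ∑ m, curvatureOp (metric r hr ψ) P (s 0) (s 1) (s 2) m * metric r hr ψ P m (s 3) :=
    fun s => rfl
  simp only [h2] at h
  rw [sum_fin_four_fun fun i j k l => (∑ m, curvatureOp (metric r hr ψ) P i j k m *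
    metric r hr ψ P m l) * (![a, b, z, w] 0 i * ![a, b, z, w] 1 j * ![a, b, z, w] 2 k *
      ![a, b, z, w] 3 l)] at h
  refine h.symm.trans ?_
  refine Finset.sum_congr rfl fun i _ => Finset.sum_congr rfl fun j _ => ?_
  rw [Matrix.toBilin'_apply]
  simp only [Matrix.mulVec, dotProduct, Matrix.of_apply, Finset.sum_mul, Finset.mul_sum,
    Matrix.cons_val]
  refine Finset.sum_comm.trans (Eq.trans (Finset.sum_congr rfl fun l _ => ?_) Finset.sum_comm)
  refine Finset.sum_comm.trans (Finset.sum_congr rfl fun m _ => Finset.sum_congr rfl fun k _ => ?_)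
  ring

theorem hasNoParallelSplitting_metric (hψ₂ : ∀ t, 0 < iteratedDeriv 2 ψ t) :
    HasNoParallelSplitting (metric r hr ψ) := by
  intro E hE hidem hself hpar
  have hΓ : ∀ k i j, ContDiff ℝ ∞ fun p => christoffel (metric r hr ψ) p k i j := fun k i j => by
    have h := fun a => contDiff_grad hr hψ a
    simp only [christoffel_metric hr hψ]
    fun_prop
  have hpt : ∀ P, E P = 0 ∨ E P = 1 := by
    intro P
    set c := iteratedDeriv 2 ψ (P (.u (lastIdx r hr)))
    have hmm : ∀ z, (E P).mulVec ((E P).mulVec z) = (E P).mulVec z := fun z => by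
      rw [Matrix.mulVec_mulVec, hidem]
    have hcomm : ∀ a b z w, curvForm (hessForm hr c) a b ((E P).mulVec z) w =
        curvForm (hessForm hr c) a b z ((E P).mulVec w) := by
      intro a b z w
      rw [curvForm_eq_sum hr hψ, curvForm_eq_sum hr hψ]
      refine Finset.sum_congr rfl fun i _ => Finset.sum_congr rfl fun j _ => ?_
      rw [← hself, Matrix.mulVec_mulVec, Matrix.mulVec_mulVec]
      congr 4
      ext l k
      simp only [Matrix.mul_apply, Matrix.of_apply]
      rw [curvatureOp_comm_of_parallel hE hΓ hpar]
      exact Finset.sum_congr rfl fun m _ => mul_comm _ _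
    -- E can be moved across the last two slots, so R(a, b, E z, w) = R(a, b, z, E w), which is zero
    -- for w in the kernel.
    have hzero : ∀ a b, ∀ z ∈ LinearMap.range (E P).mulVecLin, ∀ w ∈ LinearMap.ker (E P).mulVecLin,
        curvForm (hessForm hr c) a b z w = 0 := by
      rintro a b _ ⟨z, rfl⟩ w hw
      rw [LinearMap.mem_ker, Matrix.mulVecLin_apply] at hw
      rw [Matrix.mulVecLin_apply, hcomm, hw]
      simp [curvForm, bilin]
    have hcompl : IsCompl (LinearMap.range (E P).mulVecLin) (LinearMap.ker (E P).mulVecLin) := by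
      constructor
      · rw [Submodule.disjoint_def]
        rintro _ ⟨z, rfl⟩ hz
        rw [LinearMap.mem_ker, Matrix.mulVecLin_apply, Matrix.mulVecLin_apply, hmm] at hz
        rw [Matrix.mulVecLin_apply, hz]
      · rw [codisjoint_iff, eq_top_iff]
        intro z _
        refine Submodule.mem_sup.2 ⟨_, ⟨z, rfl⟩, z - (E P).mulVec z, ?_, ?_⟩
        · rw [LinearMap.mem_ker, Matrix.mulVecLin_apply, Matrix.mulVec_sub, hmm, sub_self]
        · rw [Matrix.mulVecLin_apply, add_sub_cancel]
    have hS := hessForm_comm hr c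
    rcases eq_bot_of_curvForm_splits hr (hψ₂ _).ne' ψ P hcompl (fun x hx y hy => by
        obtain ⟨z, rfl⟩ := hx
        rw [LinearMap.mem_ker, Matrix.mulVecLin_apply] at hy
        rw [Matrix.mulVecLin_apply, hself, hy, map_zero])
      (fun v hv w hw z => by rw [curvForm_pair_symm hS]; exact hzero _ _ _ hv _ hw)
      (fun w hw v hv z => by
        rw [curvForm_pair_symm hS, curvForm_swap, hzero _ _ _ hv _ hw, neg_zero]) with h | h
    · left
      rw [LinearMap.range_eq_bot] at h
      exact Matrix.toLin'.injective (by rw [map_zero]; exact h)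
    · right
      refine Matrix.toLin'.injective (LinearMap.ext fun z => ?_)
      have hz : z - (E P).mulVec z ∈ LinearMap.ker (E P).mulVecLin := by
        rw [LinearMap.mem_ker, Matrix.mulVecLin_apply, Matrix.mulVec_sub, hmm, sub_self]
      rw [h, Submodule.mem_bot, sub_eq_zero] at hz
      rw [Matrix.toLin'_apply, Matrix.toLin'_apply, Matrix.one_mulVec, ← hz]
  -- A single diagonal entry distinguishes 0 from 1; it never takes the value 1/2, so the
  -- intermediate value theorem makes the alternative uniform in the point.
  have hcont : Continuous fun p => E p .x .x := (hE .x .x).continuous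
  have hval : ∀ p, E p .x .x ≠ 1 / 2 := fun p => by
    rcases hpt p with h | h <;> rw [h] <;> norm_num
  rcases hpt 0 with h0 | h0
  · refine .inl fun p => (hpt p).resolve_right fun h => ?_
    obtain ⟨q, hq⟩ := mem_range_of_exists_le_of_exists_ge (c := 1 / 2) hcont
      ⟨0, by rw [h0]; norm_num⟩ ⟨p, by rw [h]; norm_num⟩
    exact hval q hq
  · refine .inr fun p => (hpt p).resolve_left fun h => ?_
    obtain ⟨q, hq⟩ := mem_range_of_exists_le_of_exists_ge (c := 1 / 2) hcont
      ⟨p, by rw [h]; norm_num⟩ ⟨0, by rw [h0]; norm_num⟩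
    exact hval q hq

end NoSplitting

/-! ### Derivatives of bilinear expressions -/

section BilinearDerivatives

variable {ι : Type} [Fintype ι]

theorem hasDerivAt_toBilin' [DecidableEq ι] (M : Matrix ι ι ℝ) {v w : ℝ → ι → ℝ} {v' w' : ι → ℝ} {t : ℝ}
    (hv : HasDerivAt v v' t) (hw : HasDerivAt w w' t) :
    HasDerivAt (fun t => Matrix.toBilin' M (v t) (w t))
      (Matrix.toBilin' M v' (w t) + Matrix.toBilin' M (v t) w') t := by
  simp only [Matrix.toBilin'_apply, ← Finset.sum_add_distrib]
  refine HasDerivAt.fun_sum fun i _ => HasDerivAt.fun_sum fun j _ => ?_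
  have h1 := hasDerivAt_pi.1 hv i
  have h2 := hasDerivAt_pi.1 hw j
  exact (h1.mul_const (M i j)).mul h2

theorem contDiff_toBilin' [DecidableEq ι] (M : Matrix ι ι ℝ) {E : Type} [NormedAddCommGroup E] [NormedSpace ℝ E]
    {v w : E → ι → ℝ} (hv : ContDiff ℝ ∞ v) (hw : ContDiff ℝ ∞ w) :
    ContDiff ℝ ∞ fun e => Matrix.toBilin' M (v e) (w e) := by
  have h1 := contDiff_pi.1 hv
  have h2 := contDiff_pi.1 hw
  simp only [Matrix.toBilin'_apply]
  fun_prop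

end BilinearDerivatives

/-! ### The geodesic symmetries for ψ(t) = t² -/

section Symmetric

variable {r : ℕ} (hr : 2 ≤ r)

/-- The form `g_{3,r}`. -/
def flatForm (r : ℕ) : LinearMap.BilinForm ℝ (Coord r → ℝ) := Matrix.toBilin' (modelForm r)

/-- The Hessian of the potential for `ψ(t) = t²`. -/
def hessBilin : LinearMap.BilinForm ℝ (Coord r → ℝ) :=
  Matrix.toBilin' (Matrix.of (hessForm hr 2))

/-- The self-adjoint operator that represents the Hessian of the potential for `ψ(t) = t²`. -/
def hessMatrix : Matrix (Coord r) (Coord r) ℝ :=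
  Matrix.of fun k b => hessForm hr 2 k.dual b

/-- The coordinate vector field `∂_a`. -/
def basisVec (a : Coord r) : Coord r → ℝ := Pi.single a 1

theorem hasDerivAt_flatForm {v w : ℝ → Coord r → ℝ} {v' w' : Coord r → ℝ} {t : ℝ}
    (hv : HasDerivAt v v' t) (hw : HasDerivAt w w' t) :
    HasDerivAt (fun t => flatForm r (v t) (w t)) (flatForm r v' (w t) + flatForm r (v t) w') t :=
  hasDerivAt_toBilin' _ hv hw

theorem hasDerivAt_hessBilin {v w : ℝ → Coord r → ℝ} {v' w' : Coord r → ℝ} {t : ℝ}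
    (hv : HasDerivAt v v' t) (hw : HasDerivAt w w' t) :
    HasDerivAt (fun t => hessBilin hr (v t) (w t))
      (hessBilin hr v' (w t) + hessBilin hr (v t) w') t :=
  hasDerivAt_toBilin' _ hv hw

theorem flatForm_apply (v w : Coord r → ℝ) : flatForm r v w = ∑ a, v a * w a.dual := by
  rw [flatForm, Matrix.toBilin'_apply]
  simp [modelForm_eq]

theorem flatForm_comm (v w : Coord r → ℝ) : flatForm r v w = flatForm r w v := by
  rw [flatForm_apply, flatForm_apply, ← Equiv.sum_comp ⟨Coord.dual, Coord.dual, Coord.dual_dual,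
    Coord.dual_dual⟩]
  refine Finset.sum_congr rfl fun a _ => ?_
  change v a.dual * w a.dual.dual = _
  rw [Coord.dual_dual, mul_comm]

theorem flatForm_basisVec_y (v : Coord r → ℝ) : flatForm r v (basisVec .y) = v .x := by
  rw [flatForm_apply, Finset.sum_eq_single .x]
  · simp [basisVec]
  · intro a _ ha
    cases a <;> simp_all [basisVec]
  · simp

theorem basisVec_y_flatForm (v : Coord r → ℝ) : flatForm r (basisVec .y) v = v .x := by
  rw [flatForm_comm, flatForm_basisVec_y]

theorem hessBilin_apply (v w : Coord r → ℝ) :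
    hessBilin hr v w = ∑ a, ∑ b, v a * hessForm hr 2 a b * w b := by
  rw [hessBilin, Matrix.toBilin'_apply]; rfl

theorem hessBilin_comm (v w : Coord r → ℝ) : hessBilin hr v w = hessBilin hr w v := by
  rw [hessBilin_apply, hessBilin_apply, Finset.sum_comm]
  refine Finset.sum_congr rfl fun a _ => Finset.sum_congr rfl fun b _ => ?_
  rw [hessForm_comm]; ring

theorem hessMatrix_mulVec (v : Coord r → ℝ) (k : Coord r) :
    (hessMatrix hr).mulVec v k = ∑ b, hessForm hr 2 k.dual b * v b := rfl

theorem flatForm_hessMatrix (v w : Coord r → ℝ) :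
    flatForm r ((hessMatrix hr).mulVec v) w = hessBilin hr v w := by
  rw [flatForm_comm, flatForm_apply, hessBilin_comm, hessBilin_apply]
  simp [hessMatrix_mulVec, Finset.mul_sum, mul_assoc]

theorem hessBilin_eq_bilin (v w : Coord r → ℝ) :
    hessBilin hr v w = bilin (hessForm hr 2) v w := by
  rw [hessBilin_apply, bilin]
  exact Finset.sum_congr rfl fun a _ => Finset.sum_congr rfl fun b _ => by ring

theorem hessBilin_x (v : Coord r → ℝ) : hessBilin hr v (basisVec .x) = 0 := by
  rw [hessBilin_eq_bilin, basisVec, bilin_single]; simp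

theorem hessBilin_y (v : Coord r → ℝ) : hessBilin hr v (basisVec .y) = 0 := by
  rw [hessBilin_eq_bilin, basisVec, bilin_single]; simp

theorem x_hessBilin (v : Coord r → ℝ) : hessBilin hr (basisVec .x) v = 0 := by
  rw [hessBilin_comm, hessBilin_x]

theorem y_hessBilin (v : Coord r → ℝ) : hessBilin hr (basisVec .y) v = 0 := by
  rw [hessBilin_comm, hessBilin_y]

theorem hessMatrix_mulVec_x : (hessMatrix hr).mulVec (basisVec .x) = 0 := by
  funext k; simp [hessMatrix_mulVec, basisVec, Pi.single_apply]

theorem hessMatrix_mulVec_y : (hessMatrix hr).mulVec (basisVec .y) = 0 := by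
  funext k; simp [hessMatrix_mulVec, basisVec, Pi.single_apply]

theorem hessMatrix_mulVec_apply_x (v : Coord r → ℝ) : (hessMatrix hr).mulVec v .x = 0 := by
  simp [hessMatrix_mulVec]

theorem iteratedDeriv_one_sq (t : ℝ) : iteratedDeriv 1 (fun t : ℝ => t ^ 2) t = 2 * t := by
  simp

theorem iteratedDeriv_three_sq (t : ℝ) : iteratedDeriv 3 (fun t : ℝ => t ^ 2) t = 0 := by
  have h1 : iteratedDeriv 1 (fun t : ℝ => t ^ 2) = fun t => 2 * t := funext iteratedDeriv_one_sq
  have h2 : iteratedDeriv 2 (fun t : ℝ => t ^ 2) = fun _ => 2 := by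
    rw [iteratedDeriv_succ, h1]
    funext t
    simp
  rw [iteratedDeriv_succ, h2]
  simp

theorem grad_sq (p : Coord r → ℝ) (k : Coord r) :
    grad hr (fun t => t ^ 2) k.dual p = (hessMatrix hr).mulVec p k := by
  rw [grad, iteratedDeriv_one_sq, hessMatrix_mulVec]
  simp only [hessForm, add_mul, Finset.sum_add_distrib]
  congr 1
  rw [← sum_lastInd_mul hr p, Finset.mul_sum, Finset.mul_sum]
  exact Finset.sum_congr rfl fun b _ => by ring

theorem potential_sq (p : Coord r → ℝ) :
    potential hr (fun t => t ^ 2) p = (1 / 2) * hessBilin hr p p := by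
  rw [hessBilin_eq_bilin, bilin_hessForm, potential, bilin]
  ring

theorem toBilin'_metric_eq_flatForm (ψ : ℝ → ℝ) (p v w : Coord r → ℝ) :
    Matrix.toBilin' (metric r hr ψ p) v w =
      flatForm r v w - 2 * potential hr ψ p * (v .x * w .x) := by
  rw [toBilin'_metric, flatForm_apply]

/-- For quadratic F the gradient is linear, and the geodesic equation becomes γ'' = -x'² Jγ + 2x'
S(γ, γ') ∂_y with S the Hessian of F. -/
theorem geodesicField_sq (z : (Coord r → ℝ) × (Coord r → ℝ)) :
    (fun k => geodesicField hr (fun t => t ^ 2) k z) =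
      -(z.2 .x) ^ 2 • (hessMatrix hr).mulVec z.1 +
        (2 * z.2 .x * hessBilin hr z.1 z.2) • basisVec .y := by
  have h : ∑ i, grad hr (fun t => t ^ 2) i z.1 * z.2 i = hessBilin hr z.1 z.2 := by
    rw [← flatForm_hessMatrix, flatForm_apply, ← Equiv.sum_comp ⟨Coord.dual, Coord.dual,
      Coord.dual_dual, Coord.dual_dual⟩]
    exact Finset.sum_congr rfl fun a _ => by rw [← grad_sq]; rfl
  funext k
  rw [geodesicField, h, grad_sq]
  have hk : xi k.dual = basisVec .y k := by cases k <;> simp [basisVec]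
  rw [hk]
  simp only [Pi.add_apply, Pi.smul_apply, smul_eq_mul]
  ring

/-- A curve `W` in the `(u, v)`-space with `W'' = -J W`, where `J` represents the Hessian of the
potential, that starts at the projection of `P` with velocity `0`. -/
structure IsJacobiCurve (P : Coord r → ℝ) (W W₁ : ℝ → Coord r → ℝ) : Prop where
  contDiff : ContDiff ℝ ∞ W
  contDiff₁ : ContDiff ℝ ∞ W₁
  hasDerivAt : ∀ t, HasDerivAt W (W₁ t) t
  hasDerivAt₁ : ∀ t, HasDerivAt W₁ (-(hessMatrix hr).mulVec (W t)) t
  apply₁_x : ∀ t, W₁ t .x = 0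
  zero : W 0 = P - P .x • basisVec .x - P .y • basisVec .y
  zero₁ : W₁ 0 = 0

/-- The linear equation W'' = -J W is triangular for the same order of the coordinates as the
geodesic equation, so its global smooth solution comes from `exists_smooth_flow`. -/
theorem exists_isJacobiCurve (P : Coord r → ℝ) : ∃ W W₁, IsJacobiCurve hr P W W₁ := by
  let f : Coord r → (Coord r → ℝ) × (Coord r → ℝ) → ℝ := fun k z =>
    -grad hr (fun t => t ^ 2) k.dual z.1
  have hψ : ContDiff ℝ ∞ fun t : ℝ => t ^ 2 := by fun_prop
  have hf : ∀ k, ContDiff ℝ ∞ (f k) := fun k =>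
    ((contDiff_grad hr hψ k.dual).comp contDiff_fst).neg
  have hT : IsTriangular Coord.rank f := fun k z w h =>
    congrArg Neg.neg (grad_congr hr _ fun b hb => (h b (by simpa using hb)).1)
  obtain ⟨Γ, hΓ, h⟩ := exists_smooth_flow hf hT (P - P .x • basisVec .x - P .y • basisVec .y)
  obtain ⟨hs, h0, h1⟩ := h 0
  have hc : ContDiff ℝ ∞ fun t => Γ (0, t) := hΓ.comp (by fun_prop)
  have hd := fun t => hs.hasDerivAt isOpen_univ (Set.mem_univ t)
  have hx : ∀ t, deriv (fun t => Γ (0, t)) t .x = 0 := by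
    intro t
    -- The x-component has zero acceleration and zero initial velocity; it is compared with the zero
    -- function.
    have hz : ∀ t ∈ Set.univ, HasDerivAt (fun _ : ℝ => (0 : ℝ)) 0 t := fun t _ => hasDerivAt_const t _
    have := eq_affine_of_deriv2_eq (c := fun _ => 0) isOpen_univ Set.ordConnected_univ
      (fun t _ => (hd t .x).1) hz (fun t _ => by simpa [f] using (hd t .x).2) hz
      (Set.mem_univ 0) (Set.mem_univ t)
    simpa [h1] using this.1
  refine ⟨fun t => Γ (0, t), deriv fun t => Γ (0, t), hc, (contDiff_infty_iff_deriv.1 hc).2,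
    fun t => hasDerivAt_pi.2 fun k => (hd t k).1, fun t => hasDerivAt_pi.2 fun k => ?_,
    hx, h0, h1⟩
  have := (hd t k).2
  simp only [f, grad_sq] at this
  exact this

/-- The geodesic symmetry at `P`. -/
def reflection (P : Coord r → ℝ) (W W₁ : ℝ → Coord r → ℝ) (p : Coord r → ℝ) : Coord r → ℝ :=
  (2 : ℝ) • W (p .x - P .x) - p + (2 * P .x) • basisVec .x +
    (2 * P .y - 2 * flatForm r (W₁ (p .x - P .x)) (p - W (p .x - P .x))) • basisVec .y

/-- The differential of the geodesic symmetry at `P`. -/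
def reflectionDeriv (P : Coord r → ℝ) (W W₁ : ℝ → Coord r → ℝ) (p v : Coord r → ℝ) : Coord r → ℝ :=
  (2 * v .x) • W₁ (p .x - P .x) - v +
    (2 * v .x * hessBilin hr (W (p .x - P .x)) (p - W (p .x - P .x)) -
      2 * flatForm r (W₁ (p .x - P .x)) v +
      2 * v .x * flatForm r (W₁ (p .x - P .x)) (W₁ (p .x - P .x))) • basisVec .y

variable {hr} {P : Coord r → ℝ} {W W₁ : ℝ → Coord r → ℝ} (hW : IsJacobiCurve hr P W W₁)
include hW

theorem contDiff_reflection : ContDiff ℝ ∞ (reflection P W W₁) := by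
  have h1 := hW.contDiff
  have h2 := hW.contDiff₁
  have h3 : ContDiff ℝ ∞ fun p : Coord r → ℝ =>
      flatForm r (W₁ (p .x - P .x)) (p - W (p .x - P .x)) :=
    contDiff_toBilin' _ (by fun_prop) (by fun_prop)
  unfold reflection
  fun_prop

theorem hasDerivAt_reflection {γ : ℝ → Coord r → ℝ} {v : Coord r → ℝ} {t : ℝ}
    (h : HasDerivAt γ v t) :
    HasDerivAt (fun t => reflection P W W₁ (γ t)) (reflectionDeriv hr P W W₁ (γ t) v) t := by
  have hx : HasDerivAt (fun t => γ t .x - P .x) (v .x) t := (hasDerivAt_pi.1 h .x).sub_const _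
  have hW0 := (hW.hasDerivAt (γ t .x - P .x)).scomp t hx
  have hW1 := (hW.hasDerivAt₁ (γ t .x - P .x)).scomp t hx
  have hQ := hasDerivAt_flatForm hW1 (h.sub hW0)
  have hfin := (((hW0.const_smul (2 : ℝ)).sub h).add_const ((2 * P .x) • basisVec .x)).add
    (((hQ.const_mul 2).const_sub (2 * P .y)).smul_const (basisVec .y))
  refine hfin.congr_deriv ?_
  unfold reflectionDeriv
  simp only [Function.comp, Pi.sub_apply, map_sub, map_smul, map_neg,
    LinearMap.smul_apply, LinearMap.neg_apply, flatForm_hessMatrix, smul_eq_mul]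
  module

/-- The geodesic symmetry preserves the metric. -/
theorem toBilin'_reflection (p v w : Coord r → ℝ) :
    Matrix.toBilin' (metric r hr (fun t => t ^ 2) (reflection P W W₁ p))
      (reflectionDeriv hr P W W₁ p v) (reflectionDeriv hr P W W₁ p w) =
      Matrix.toBilin' (metric r hr (fun t => t ^ 2) p) v w := by
  have hx : ∀ v, reflectionDeriv hr P W W₁ p v .x = -v .x := fun v => by
    simp [reflectionDeriv, hW.apply₁_x, basisVec]
  rw [toBilin'_metric_eq_flatForm, toBilin'_metric_eq_flatForm, hx, hx, potential_sq, potential_sq]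
  -- The ∂_y-terms of the differential contribute the pairings with W' and with S(W, p - W); they
  -- cancel the cross terms of the flat form and the change of F from p to 2W - p.
  unfold reflection reflectionDeriv
  simp only [map_sub, map_add, map_smul, LinearMap.sub_apply, LinearMap.add_apply,
    LinearMap.smul_apply, flatForm_basisVec_y, basisVec_y_flatForm, hessBilin_x, hessBilin_y,
    x_hessBilin, y_hessBilin, smul_eq_mul, hW.apply₁_x, hessBilin_comm hr p (W _),
    flatForm_comm v (W₁ _)]
  simp [basisVec]
  ring

theorem reflection_self : reflection P W W₁ P = P := by
  unfold reflection
  rw [sub_self, hW.zero, hW.zero₁]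
  simp only [map_zero, LinearMap.zero_apply]
  module

theorem reflectionDeriv_self (v : Coord r → ℝ) : reflectionDeriv hr P W W₁ P v = -v := by
  unfold reflectionDeriv
  rw [sub_self, hW.zero, hW.zero₁]
  simp only [map_zero, LinearMap.zero_apply, map_sub, map_smul, hessBilin_x, hessBilin_y, LinearMap.sub_apply, LinearMap.smul_apply, x_hessBilin, y_hessBilin]
  simp

/-- The geodesic symmetry maps geodesics to geodesics. -/
theorem isSolutionOn_reflection {γ : ℝ → Coord r → ℝ} (hγc : ContDiff ℝ 2 γ)
    (hγ : IsSolutionOn (geodesicField hr fun t => t ^ 2) γ Set.univ) :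
    IsSolutionOn (geodesicField hr fun t => t ^ 2) (fun t => reflection P W W₁ (γ t)) Set.univ ∧
      deriv (fun t => reflection P W W₁ (γ t)) =
        fun t => reflectionDeriv hr P W W₁ (γ t) (deriv γ t) := by
  have hd : ∀ t, HasDerivAt γ (deriv γ t) t := fun t =>
    hasDerivAt_pi.2 fun k => (hγ.hasDerivAt isOpen_univ (Set.mem_univ t) k).1
  have hdd : ∀ t, HasDerivAt (deriv γ) (-(deriv γ t .x) ^ 2 • (hessMatrix hr).mulVec (γ t) +
        (2 * deriv γ t .x * hessBilin hr (γ t) (deriv γ t)) • basisVec .y) t := fun t => by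
    rw [← geodesicField_sq hr (γ t, deriv γ t)]
    exact hasDerivAt_pi.2 fun k => (hγ.hasDerivAt isOpen_univ (Set.mem_univ t) k).2
  have e : deriv (fun t => reflection P W W₁ (γ t)) =
      fun t => reflectionDeriv hr P W W₁ (γ t) (deriv γ t) :=
    funext fun t => (hasDerivAt_reflection hW (hd t)).deriv
  refine ⟨⟨((contDiff_infty.1 (contDiff_reflection hW) 2).comp hγc).contDiffOn,
    fun t _ k => ?_⟩, e⟩
  rw [e]
  have hx : HasDerivAt (fun t => γ t .x - P .x) (deriv γ t .x) t :=
    (hasDerivAt_pi.1 (hd t) .x).sub_const _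
  have hW0 := (hW.hasDerivAt (γ t .x - P .x)).scomp t hx
  have hW1 := (hW.hasDerivAt₁ (γ t .x - P .x)).scomp t hx
  -- The x-coordinate of a geodesic is affine in t, so its acceleration drops out of the derivatives
  -- that follow.
  have hc : HasDerivAt (fun t => deriv γ t .x) 0 t := by
    have := hasDerivAt_pi.1 (hdd t) .x
    simpa [hessMatrix_mulVec_apply_x, basisVec] using this
  have hH := hasDerivAt_hessBilin hr hW0 ((hd t).sub hW0)
  have hQ1 := hasDerivAt_flatForm hW1 (hdd t)
  have hQ2 := hasDerivAt_flatForm hW1 hW1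
  have hc2 := hc.const_mul 2
  have hfin := ((hc2.smul hW1).sub (hdd t)).add
    ((((hc2.mul hH).sub (hQ1.const_mul 2)).add (hc2.mul hQ2)).smul_const (basisVec .y))
  have hfin' : HasDerivAt (fun t => reflectionDeriv hr P W W₁ (γ t) (deriv γ t)) _ t := hfin
  rw [hfin'.deriv, congrFun (geodesicField_sq hr _) k]
  refine congrFun ?_ k
  have hcx : reflectionDeriv hr P W W₁ (γ t) (deriv γ t) .x = -deriv γ t .x := by
    simp [reflectionDeriv, hW.apply₁_x, basisVec]
  simp only [hcx]
  unfold reflection reflectionDeriv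
  simp only [Function.comp, Pi.sub_apply, map_sub, map_add, map_smul, map_neg, LinearMap.sub_apply,
    LinearMap.add_apply, LinearMap.smul_apply, LinearMap.neg_apply, flatForm_basisVec_y,
    hessBilin_y, x_hessBilin, y_hessBilin, smul_eq_mul, hW.apply₁_x,
    flatForm_hessMatrix, flatForm_comm (W₁ _) ((hessMatrix hr).mulVec _),
    Matrix.mulVec_add, Matrix.mulVec_sub, Matrix.mulVec_smul, hessMatrix_mulVec_x,
    hessMatrix_mulVec_y, hessBilin_comm hr (γ t) (W₁ _),
    hessBilin_comm hr (W₁ _) (W _)]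
  module

end Symmetric

/-! ### The symmetric space -/

section SymmetricSpace

variable {r : ℕ} (hr : 2 ≤ r)

theorem isSymmetricSpace_metric : IsSymmetricSpace (metric r hr fun t => t ^ 2) := by
  intro P
  have hψ : ContDiff ℝ ∞ fun t : ℝ => t ^ 2 := by fun_prop
  obtain ⟨W, W₁, hW⟩ := exists_isJacobiCurve hr P
  obtain ⟨D, hD⟩ := expIsDiffeo_metric hr hψ P
  -- The reflected geodesic starts at P with velocity -v, and it ends at the reflection of exp_P(v).
  have hexp : ∀ v, ExpEq (metric r hr fun t => t ^ 2) P (-v) (reflection P W W₁ (D v)) := by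
    intro v
    obtain ⟨Γ, hΓ, h⟩ := exists_smooth_flow (contDiff_geodesicField hr hψ)
      (isTriangular_geodesicField hr _) P
    obtain ⟨hs, h0, h1⟩ := h v
    have hDv : D v = Γ (v, 1) := (hD v _).1 ⟨Set.univ, _, isOpen_univ, Set.ordConnected_univ,
      Set.subset_univ _, (isGeodesicOn_iff hr hψ _ _).2 hs, h0, h1, rfl⟩
    obtain ⟨hσ, hσ'⟩ := isSolutionOn_reflection hW (contDiffOn_univ.1 hs.1) hs
    refine ⟨Set.univ, _, isOpen_univ, Set.ordConnected_univ, Set.subset_univ _,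
      (isGeodesicOn_iff hr hψ _ _).2 hσ, ?_, ?_, ?_⟩
    · simp only [h0, reflection_self hW]
    · rw [hσ']
      simp only [h0, h1, reflectionDeriv_self hW]
    · simp only [hDv]
  have hneg : ∀ v, D (-v) = reflection P W W₁ (D v) := fun v => (hD _ _).1 (hexp v)
  -- Conjugating -1 by the exponential map gives a diffeomorphism at once; by `hneg` it coincides
  -- with the explicit reflection.
  let S := (D.symm.trans (ContinuousLinearEquiv.neg ℝ).toDiffeomorph).trans D
  have hS : ∀ p, S p = reflection P W W₁ p := fun p => by
    have := hneg (D.symm p)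
    rw [D.apply_symm_apply] at this
    exact this
  have hfd : ∀ p v, fderiv ℝ S p v = reflectionDeriv hr P W W₁ p v := by
    intro p v
    -- The differential of the reflection is known along curves, so it is read off on straight
    -- lines.
    have hline : HasDerivAt (fun t : ℝ => p + t • v) v 0 := by
      simpa using ((hasDerivAt_id (0 : ℝ)).smul_const v).const_add p
    have h1 := hasDerivAt_reflection hW hline
    have hSd : Differentiable ℝ S := by
      rw [show (S : (Coord r → ℝ) → Coord r → ℝ) = reflection P W W₁ from funext hS]
      exact (contDiff_reflection hW).differentiable (by simp)
    have h2 := ((hSd (p + (0 : ℝ) • v)).hasFDerivAt.comp_hasDerivAt (0 : ℝ) hline)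
    have h3 : (S ∘ fun t : ℝ => p + t • v) = fun t => reflection P W W₁ (p + t • v) :=
      funext fun t => hS _
    rw [h3] at h2
    simpa using h2.unique h1
  refine ⟨S, fun p v w => ?_, ?_, fun v => ?_, fun v Q Q' hQ hQ' => ?_⟩
  · rw [hS, hfd, hfd, toBilin'_reflection hW]
  · rw [hS, reflection_self hW]
  · rw [hfd, reflectionDeriv_self hW]
  · rw [hS, ← (hD _ _).1 hQ, ← (hD _ _).1 hQ', hneg]

end SymmetricSpace

end CurvHom

end

theorem theorem1p5 (r : ℕ) (hr : 2 ≤ r) (ψ : ℝ → ℝ) (hψ : ContDiff ℝ ∞ ψ)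
    (hψ₂ : ∀ t, 0 < iteratedDeriv 2 ψ t) :
    -- a pseudo-Riemannian metric of neutral signature
    (IsPseudoRiemannian (metric r hr ψ) ∧
      ∀ P, HasSignature (Matrix.toBilin' (metric r hr ψ P)) (r + 1) (r + 1)) ∧
    -- (1) all geodesics extend for infinite time
    IsGeodesicallyComplete (metric r hr ψ) ∧
    -- (2) the exponential map is a diffeomorphism at each point
    (∀ P, ExpIsDiffeo (metric r hr ψ) P) ∧
    -- (3) the non-zero components of R and of ∇R, up to the usual symmetries
    ((∀ P, (tangentModel (metric r hr ψ) 1 P).IsAlgebraic) ∧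
      (∀ P, riemann (metric r hr ψ) P
          ![.x, .u (lastIdx r hr), .u (lastIdx r hr), .x] =
        iteratedDeriv 2 ψ (P (.u (lastIdx r hr)))) ∧
      (∀ P, ∀ i : Fin (r - 1), riemann (metric r hr ψ) P
          ![.x, .u (lowIdx r i), .v (nextIdx r i), .x] = 1) ∧
      (∀ P s, riemann (metric r hr ψ) P s ≠ 0 →
        s ∈ z2Orbit .x (.u (lastIdx r hr)) (.u (lastIdx r hr)) .x ∨
        ∃ i : Fin (r - 1), s ∈ z2Orbit .x (.u (lowIdx r i)) (.v (nextIdx r i)) .x) ∧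
      (∀ P, covDeriv (metric r hr ψ) (riemann (metric r hr ψ)) P
          ![.x, .u (lastIdx r hr), .u (lastIdx r hr), .x, .u (lastIdx r hr)] =
        iteratedDeriv 3 ψ (P (.u (lastIdx r hr)))) ∧
      (∀ P s, covDeriv (metric r hr ψ) (riemann (metric r hr ψ)) P s ≠ 0 →
        s 4 = .u (lastIdx r hr) ∧
        (fun a : Fin 4 => s a.castSucc) ∈
          z2Orbit .x (.u (lastIdx r hr)) (.u (lastIdx r hr)) .x)) ∧
    -- (4) an irreducible 0-model
    ((modelU r hr).IsModelFor (metric r hr ψ) ∧ (modelU r hr).IsIrreducible) ∧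
    -- (5) an irreducible symmetric space
    ((∀ t, ψ t = t ^ 2) →
      IsSymmetricSpace (metric r hr ψ) ∧
      (∀ P s, covDeriv (metric r hr ψ) (riemann (metric r hr ψ)) P s = 0) ∧
      (∀ P, (tangentModel (metric r hr ψ) 0 P).IsIrreducible) ∧
      HasNoParallelSplitting (metric r hr ψ)) ∧
    -- (6) 1-curvature homogeneous, with an explicit 1-model, but not 2-curvature homogeneous
    ((∀ t, 0 < iteratedDeriv 3 ψ t) →
      (modelU₁ r hr).IsModelFor (metric r hr ψ) ∧
      IsCurvatureHomogeneous 1 (metric r hr ψ) ∧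
      ¬ IsCurvatureHomogeneous 2 (metric r hr ψ)) := by
  refine ⟨⟨isPseudoRiemannian_metric hr hψ, hasSignature_metric hr ψ⟩,
    isGeodesicallyComplete_metric hr hψ, expIsDiffeo_metric hr hψ,
    ⟨isAlgebraic_tangentModel hr hψ, riemann_metric_last hr hψ, riemann_metric_low hr hψ,
      mem_of_riemann_metric_ne_zero hr hψ, covDeriv_riemann_metric_last hr hψ,
      mem_of_covDeriv_riemann_metric_ne_zero hr hψ⟩,
    ⟨isModelFor_modelU hr hψ hψ₂, isIrreducible_modelU hr⟩, fun hsq => ?_, fun hψ₃ => ?_⟩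
  · obtain rfl : ψ = fun t => t ^ 2 := funext hsq
    refine ⟨isSymmetricSpace_metric hr, fun P s => ?_, isIrreducible_tangentModel hr hψ hψ₂,
      hasNoParallelSplitting_metric hr hψ hψ₂⟩
    rw [covDeriv_riemann_metric hr hψ, iteratedDeriv_three_sq, zero_mul, zero_mul]
  · exact ⟨isModelFor_modelU₁ hr hψ hψ₂ hψ₃, ⟨_, _, _, _, isModelFor_modelU₁ hr hψ hψ₂ hψ₃⟩,
      not_isCurvatureHomogeneous_two hr hψ hψ₃⟩
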